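/- Let $\mathbb F_q$ be a finite field of odd order $q$ and characteristic $p$, let $d$ be odd, and for $r\in\mathbb F_q$ let $S_r=\{x\in\mathbb F_q^d:\sum_j x_j^2=r\}$. Radii are assumed to satisfy $S_r\neq\emptyset$ (this is automatic for $d\ge 3$). *Oracle.* Let $A,B$ be finite abelian groups whose nonzero elements serve as labels and whose element $0$ is the blank symbol. A hidden radius oracle for $r$ is given by an injective encryption $\sigma:S_r\to A\setminus\{0\}$ of the offsets and an injective encryption $\tau:\mathbb F_q^d\to B\setminus\{0\}$ of the centers. It computes two functions: $f_1(x,\sigma(s))=\tau(x-s)$ for $x\in\mathbb F_q^d$ and $s\in S_r$, and $f_{-1}(x,\tau(t))=\sigma(x-t)$ whenever $x-t\in S_r$; both return $0$ on every other input. A quantum query is one application of $|x,a,b\rangle\mapsto|x,a,b+f_1(x,a)\rangle$ or of $|x,a,b\rangle\mapsto|x,a+f_{-1}(x,b),b\rangle$. A quantum query algorithm starts from a fixed basis state, alternates queries with oracle-independent unitaries (on these registers and a finite work space), measures in the computational basis, and outputs a function of the outcome. *Fourier sampling.* With $\omega_p=e^{2\pi i/p}$, let $|S_r+t\rangle$ be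 the normalized uniform superposition over $S_r+t$, let $\rho_r=q^{-d}\sum_{t\in\mathbb F_q^d}|S_r+t\rangle\langle S_r+t|$, let $U=q^{-d/2}\sum_{k,x\in\mathbb F_q^d}\omega_p^{\operatorname{Tr}(k\cdot x)}|k\rangle\langle x|$ with $\operatorname{Tr}$ the trace from $\mathbb F_q$ to $\mathbb F_p$, and let $\Pr(k|r)=\langle k|U\rho_rU^\dagger|k\rangle$ be the resulting distribution of $k$. **Theorem.** 1. For every $K\in\mathbb N$ and $\varepsilon>0$ there are constants $C,c$ such that for all odd $q$, all odd $d$ and all label groups $A,B$ with $|A|\le Kq^{d-1}$ there is a quantum query algorithm, depending only on $(\mathbb F_q,d,A,B,K,\varepsilon)$, that makes at most $C(\log q)^c$ queries and that, for every radius $r$ with $S_r\ne\emptyset$ and every hidden radius oracle for $r$ with labels in $A$ and $B$, outputs $r$ with probability at least $1-\varepsilon$. 2. There is an absolute constant $\delta>0$ such that for all odd $q$, all odd $d$ and all $r\neq r'$ with $S_r,S_{r'}\neq\emptyset$, the distributions $\Pr(\cdot|r)$ and $\Pr(\cdot|r')$ have total variation distance $\frac12\sum_k|\Pr(k|r)-\Pr(k|r')|\ge\delta$.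 3. If moreover $r$ and $r'$ have the same quadratic character, this total variation distance is at least $\frac14$. -/

import Mathlib

open scoped Classical in
/-- The sphere of radius `r` centred at the origin of `F^d`, i.e. the points `x` with
`x_1 ^ 2 + ... + x_d ^ 2 = r`. -/
noncomputable def radiusSphere {F : Type} [Field F] [Fintype F] (d : ℕ) (r : F) :
    Finset (Fin d → F) :=
  Finset.univ.filter fun x => ∑ j, x j ^ 2 = r

/-! ## The hidden radius oracle -/

/-- The data behind a black box hiding the radius `r`: an encryption of the points of the sphere
of radius `r` by elements of `A`, and an encryption of the possible centres by elements of `B`.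
Labels are nonzero elements of the finite abelian groups `A` and `B`; the element `0` is kept as
the blank symbol, which is also the answer to an invalid query. -/
structure HiddenRadiusOracle (F : Type) [Field F] [Fintype F] (d : ℕ)
    (A B : Type) [AddCommGroup A] [AddCommGroup B] (r : F) where
  /-- encryption of the offsets `s` with `s` on the sphere -/
  encOffset : {s : Fin d → F // s ∈ radiusSphere d r} ↪ {a : A // a ≠ 0}
  /-- encryption of the centres `t` -/
  encCenter : (Fin d → F) ↪ {b : B // b ≠ 0}

namespace HiddenRadiusOracle

variable {F : Type} [Field F] [Fintype F] {d : ℕ}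
  {A B : Type} [AddCommGroup A] [AddCommGroup B] {r : F}

open scoped Classical in
/-- The black box `f₁`: on a point `x` and the encryption `a` of an offset `s`, it returns the
encryption of the centre `x - s`; it returns `0` if `a` encrypts no point of the sphere. -/
noncomputable def fwd (O : HiddenRadiusOracle F d A B r) (x : Fin d → F) (a : A) : B :=
  if h : ∃ s, (O.encOffset s : A) = a then (O.encCenter (x - h.choose.1) : B) else 0

open scoped Classical in
/-- The black box `f₋₁`: on a point `x` and the encryption `b` of a centre `t`, it returns the
encryption of the offset `x - t`; it returns `0` if there are no `t` and no offset `s = x - t` on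
the sphere such that `b` is the encryption of `t`. -/
noncomputable def bwd (O : HiddenRadiusOracle F d A B r) (x : Fin d → F) (b : B) : A :=
  if h : ∃ s : {s : Fin d → F // s ∈ radiusSphere d r}, (O.encCenter (x - s.1) : B) = b then
    (O.encOffset h.choose : A) else 0

theorem fwd_encOffset (O : HiddenRadiusOracle F d A B r) (x : Fin d → F)
    (s : {s : Fin d → F // s ∈ radiusSphere d r}) :
    O.fwd x (O.encOffset s) = O.encCenter (x - s.1) := by
  have h : ∃ s', (O.encOffset s' : A) = O.encOffset s := ⟨s, rfl⟩
  have h' : h.choose = s := O.encOffset.injective (Subtype.ext h.choose_spec)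
  rw [fwd, dif_pos h, h']

theorem bwd_encCenter (O : HiddenRadiusOracle F d A B r) (x : Fin d → F)
    (s : {s : Fin d → F // s ∈ radiusSphere d r}) :
    O.bwd x (O.encCenter (x - s.1)) = O.encOffset s := by
  have h : ∃ s' : {s : Fin d → F // s ∈ radiusSphere d r},
      (O.encCenter (x - s'.1) : B) = O.encCenter (x - s.1) := ⟨s, rfl⟩
  have h' : h.choose = s := Subtype.ext
    (sub_right_injective (O.encCenter.injective (Subtype.ext h.choose_spec)))
  rw [bwd, dif_pos h, h']

end HiddenRadiusOracle

/-! ## Quantum query algorithms -/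

/-- The computational basis: a point register, an offset-label register, a centre-label register,
and a work space `W`. -/
abbrev QReg (F : Type) (d : ℕ) (A B W : Type) : Type := (Fin d → F) × A × B × W

/-- Which of the two black boxes is queried. -/
inductive QueryKind
  | fwd
  | bwd

/-- The quantum oracle. A query to `f₁` is the unitary
`|x, a, b, w⟩ ↦ |x, a, b + f₁(x, a), w⟩`, and a query to `f₋₁` is the unitary
`|x, a, b, w⟩ ↦ |x, a + f₋₁(x, b), b, w⟩`; here they act on vectors of amplitudes. -/
noncomputable def HiddenRadiusOracle.query {F : Type} [Field F] [Fintype F] {d : ℕ}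
    {A B : Type} [AddCommGroup A] [AddCommGroup B] {r : F}
    (O : HiddenRadiusOracle F d A B r) {W : Type} (κ : QueryKind)
    (ψ : QReg F d A B W → ℂ) : QReg F d A B W → ℂ :=
  match κ with
  | .fwd => fun (x, a, b, w) => ψ (x, a, b - O.fwd x a, w)
  | .bwd => fun (x, a, b, w) => ψ (x, a - O.bwd x b, b, w)

/-- A quantum query algorithm that returns an element of `F`: starting from a computational basis
state it applies a unitary, then alternates queries with further unitaries, and finally measures
all registers in the computational basis and applies a function to the outcome. Nothing here
depends on the hidden oracle. -/
structure QueryAlgorithm (F : Type) [Field F] [Fintype F] [DecidableEq F] (d : ℕ)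
    (A B : Type) [AddCommGroup A] [Fintype A] [DecidableEq A]
    [AddCommGroup B] [Fintype B] [DecidableEq B] where
  W : Type
  [fintypeW : Fintype W]
  [decidableEqW : DecidableEq W]
  w₀ : W
  first : Matrix.unitaryGroup (QReg F d A B W) ℂ
  /-- each entry is a query followed by a unitary -/
  steps : List (QueryKind × Matrix.unitaryGroup (QReg F d A B W) ℂ)
  output : QReg F d A B W → F

namespace QueryAlgorithm

attribute [instance] QueryAlgorithm.fintypeW QueryAlgorithm.decidableEqW

variable {F : Type} [Field F] [Fintype F] [DecidableEq F] {d : ℕ}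
  {A B : Type} [AddCommGroup A] [Fintype A] [DecidableEq A]
  [AddCommGroup B] [Fintype B] [DecidableEq B]

/-- The number of queries made. -/
def numQueries (alg : QueryAlgorithm F d A B) : ℕ := alg.steps.length

/-- The state before the final measurement, for a given oracle. -/
noncomputable def finalState (alg : QueryAlgorithm F d A B) {r : F}
    (O : HiddenRadiusOracle F d A B r) : QReg F d A B alg.W → ℂ :=
  alg.steps.foldl (fun ψ st => Matrix.mulVec st.2.1 (O.query st.1 ψ))
    (Matrix.mulVec alg.first.1 (Pi.single ((0, 0, 0, alg.w₀) : QReg F d A B alg.W) (1 : ℂ)))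

/-- The probability that the algorithm returns `v`. -/
noncomputable def prob (alg : QueryAlgorithm F d A B) {r : F}
    (O : HiddenRadiusOracle F d A B r) (v : F) : ℝ :=
  ∑ z : QReg F d A B alg.W, if alg.output z = v then ‖alg.finalState O z‖ ^ 2 else 0

end QueryAlgorithm

/-! ## Fourier sampling of the hidden radius state -/

section FourierSampling

variable {F : Type} [Field F] [Fintype F] {d : ℕ}

/-- `exp (2 π i Tr(a) / p)`, with `p` the characteristic of `F` and `Tr` the absolute trace. -/
noncomputable def traceChar (a : F) : ℂ :=
  letI : Algebra (ZMod (ringChar F)) F := ZMod.algebra F (ringChar F)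
  Complex.exp (2 * Real.pi * Complex.I *
    ((Algebra.trace (ZMod (ringChar F)) F a).val : ℂ) / (ringChar F : ℂ))

open scoped Classical in
/-- The normalized uniform superposition over the sphere of radius `r` centred at `t`. -/
noncomputable def sphereState (r : F) (t : Fin d → F) : (Fin d → F) → ℂ := fun x =>
  if x - t ∈ radiusSphere d r then ((1 / Real.sqrt (radiusSphere d r).card : ℝ) : ℂ) else 0

/-- The hidden radius state: the sphere state averaged over a uniformly random centre. -/
noncomputable def hiddenRadiusState (d : ℕ) (r : F) : Matrix (Fin d → F) (Fin d → F) ℂ :=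
  (1 / (Fintype.card F : ℂ) ^ d) •
    ∑ t : Fin d → F, Matrix.vecMulVec (sphereState r t) (star (sphereState r t))

/-- The Fourier transform over `F^d`. -/
noncomputable def fourierMatrix (F : Type) [Field F] [Fintype F] (d : ℕ) :
    Matrix (Fin d → F) (Fin d → F) ℂ :=
  Matrix.of fun k x =>
    ((1 / Real.sqrt ((Fintype.card F : ℝ) ^ d) : ℝ) : ℂ) * traceChar (k ⬝ᵥ x)

/-- The probability of the outcome `k` when the hidden radius state of radius `r` is Fourier
transformed and measured in the computational basis. -/
noncomputable def fourierProb (r : F) (k : Fin d → F) : ℝ :=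
  ((fourierMatrix F d * hiddenRadiusState d r * (fourierMatrix F d).conjTranspose) k k).re

/-- The total variation distance between the Fourier sampling distributions of two radii. -/
noncomputable def fourierTV (d : ℕ) (r r' : F) : ℝ :=
  (1 / 2) * ∑ k : Fin d → F, |fourierProb r k - fourierProb r' k|

end FourierSampling

/-! Write ψ for the trace character, χ for the quadratic character and G for the Gauss sum, so |G|²
= q. Translating a sphere only multiplies its Fourier transform by a phase, so Pr(k|r) = |Ŝ_r(k)|² /
(q^d |S_r|). Detecting the equation of the sphere by additive characters splits Ŝ_r(k) into
one-dimensional quadratic Gauss sums. Since d is odd, χ(a)^d = χ(a) survives and what remains is a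
Salié sum, which has a closed form (`card_mul_sqrtSum`): a sum of ψ over the square roots of (k·k)r.
Hence for m = k·k ≠ 0 (`fourierProb_eq_sqrtSum`, `sqrtSum_sq`), Pr(k|r) is 0 if mr is a nonsquare
and (2 + 2 cos 2v)/(q|S_r|) if mr = v² ≠ 0, where cos is the real part of ψ.

Two radii are then compared by elementary cosine sums. If their characters agree, orthogonality of
cosines separates them; if both are nonzero and the characters differ, the supports are disjoint
away from k·k = 0; radius 0 has a flat distribution there. The uniform bound is 1/12
(`fourierTV_ge`).

For the algorithm, a query to f₁ on a uniform superposition, a sign change of the offset label and a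
query to f₋₁ that erases this label leave a sphere state about a hidden centre, with probability
|S_r|/|A| ≥ 2/(3K); the failed branch is marked by a blank centre label. Fourier transforming gives
a sample of Pr(·|r). Maximum likelihood on n independent samples errs with probability at most q
β^n, where β < 1 bounds the Bhattacharyya coefficients of the outcome distributions
(`sum_sqrt_mul_le`, `one_sub_le_sum_strictArgmax`), so n = O(log q) suffices. -/

/-! ## The trace character and quadratic Gauss sums -/

section CharacterSums

variable {F : Type} [Field F] [Fintype F]

/-- The trace character as an additive character. -/
noncomputable def traceAddChar (F : Type) [Field F] [Fintype F] : AddChar F ℂ :=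
  letI : Algebra (ZMod (ringChar F)) F := ZMod.algebra F (ringChar F)
  haveI : NeZero (ringChar F) := ⟨CharP.ringChar_ne_zero_of_finite F⟩
  ZMod.stdAddChar.compAddMonoidHom (Algebra.trace (ZMod (ringChar F)) F).toAddMonoidHom

theorem traceChar_eq (a : F) : traceChar a = traceAddChar F a := by
  let : Algebra (ZMod (ringChar F)) F := ZMod.algebra F (ringChar F)
  have : NeZero (ringChar F) := ⟨CharP.ringChar_ne_zero_of_finite F⟩
  have h : ∀ z : ZMod (ringChar F), ZMod.stdAddChar z =
      Complex.exp (2 * Real.pi * Complex.I * (z.val : ℂ) / (ringChar F : ℂ)) := by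
    intro z
    have := ZMod.stdAddChar_coe (N := ringChar F) (z.val : ℤ)
    rwa [Int.cast_natCast, Int.cast_natCast, ZMod.natCast_zmod_val] at this
  exact (h _).symm

theorem traceAddChar_ne_one : traceAddChar F ≠ 1 := by
  let : Algebra (ZMod (ringChar F)) F := ZMod.algebra F (ringChar F)
  have : NeZero (ringChar F) := ⟨CharP.ringChar_ne_zero_of_finite F⟩
  obtain ⟨a, ha⟩ := FiniteField.trace_to_zmod_nondegenerate F (one_ne_zero (α := F))
  intro h
  apply ha
  have h1 : traceAddChar F (1 * a) = 1 := by rw [h]; rfl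
  apply ZMod.injective_stdAddChar
  rw [AddChar.map_zero_eq_one]
  exact h1

theorem traceAddChar_isPrimitive : (traceAddChar F).IsPrimitive :=
  AddChar.IsPrimitive.of_ne_one traceAddChar_ne_one

theorem sum_traceAddChar_mul [DecidableEq F] (b : F) :
    ∑ x, traceAddChar F (x * b) = if b = 0 then (Fintype.card F : ℂ) else 0 := by
  rw [AddChar.sum_mulShift b traceAddChar_isPrimitive]
  split_ifs <;> simp

theorem norm_traceAddChar (a : F) : ‖traceAddChar F a‖ = 1 := AddChar.norm_apply _ _

theorem traceAddChar_sum {ι : Type*} (s : Finset ι) (f : ι → F) :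
    traceAddChar F (∑ i ∈ s, f i) = ∏ i ∈ s, traceAddChar F (f i) := by
  classical
  induction s using Finset.induction_on with
  | empty => simp
  | insert i s hi ih => rw [Finset.sum_insert hi, Finset.prod_insert hi, AddChar.map_add_eq_mul, ih]

variable [DecidableEq F]

/-- The complex valued quadratic character. -/
noncomputable def quadCharC (F : Type) [Field F] [Fintype F] [DecidableEq F] : MulChar F ℂ :=
  (quadraticChar F).ringHomComp (Int.castRingHom ℂ)

theorem quadCharC_apply (a : F) : quadCharC F a = (quadraticChar F a : ℂ) := rfl

theorem quadCharC_mul_self {a : F} (ha : a ≠ 0) : quadCharC F a * quadCharC F a = 1 := by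
  rw [quadCharC_apply, ← Int.cast_mul, ← sq, quadraticChar_sq_one ha, Int.cast_one]

theorem norm_quadCharC {a : F} (ha : a ≠ 0) : ‖quadCharC F a‖ = 1 := by
  rw [quadCharC_apply]
  rcases quadraticChar_dichotomy ha with h | h <;> simp [h]

theorem quadCharC_inv (a : F) : quadCharC F a⁻¹ = quadCharC F a := by
  rcases eq_or_ne a 0 with rfl | ha
  · rw [inv_zero]
  · have h1 : quadCharC F a⁻¹ * quadCharC F a = 1 := by
      rw [← map_mul, inv_mul_cancel₀ ha, map_one]
    have h2 := quadCharC_mul_self ha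
    have h3 : quadCharC F a ≠ 0 := by
      intro h; rw [h] at h2; simp at h2
    exact mul_right_cancel₀ h3 (h1.trans h2.symm)

theorem quadCharC_pow {a : F} {d : ℕ} (hd : Odd d) : quadCharC F a ^ d = quadCharC F a := by
  obtain ⟨e, rfl⟩ := hd
  rcases eq_or_ne a 0 with rfl | ha
  · rw [MulChar.map_zero]
    exact zero_pow (Nat.succ_ne_zero _)
  · rw [pow_succ, pow_mul, sq, quadCharC_mul_self ha, one_pow, one_mul]

/-- The quadratic Gauss sum of the trace character. -/
noncomputable def quadGauss (F : Type) [Field F] [Fintype F] [DecidableEq F] : ℂ :=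
  gaussSum (quadCharC F) (traceAddChar F)

theorem quadCharC_ne_one (hF : ringChar F ≠ 2) : quadCharC F ≠ 1 := by
  obtain ⟨a, ha⟩ := quadraticChar_exists_neg_one' hF
  intro h
  have h1 := quadCharC_apply (a : F)
  rw [h, ha, MulChar.one_apply_coe] at h1
  norm_num at h1

theorem norm_quadGauss_sq (hF : ringChar F ≠ 2) : ‖quadGauss F‖ ^ 2 = Fintype.card F := by
  have h2 : (quadCharC F).IsQuadratic := (quadraticChar_isQuadratic F).comp _
  have h := gaussSum_sq (quadCharC_ne_one hF) h2 (traceAddChar_isPrimitive (F := F))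
  have h' := congrArg norm h
  rw [norm_pow, norm_mul, norm_quadCharC (neg_ne_zero.mpr one_ne_zero), one_mul] at h'
  simpa [quadGauss] using h'

theorem sum_quadCharC_mul_traceAddChar (hF : ringChar F ≠ 2) (a : F) :
    ∑ y, quadCharC F y * traceAddChar F (a * y) = quadCharC F a * quadGauss F := by
  rcases eq_or_ne a 0 with rfl | ha
  · simp [MulChar.map_zero, MulChar.sum_eq_zero_of_ne_one (quadCharC_ne_one hF)]
  · have h := gaussSum_mulShift (quadCharC F) (traceAddChar F) (Units.mk0 a ha)
    rw [quadGauss, ← h, ← mul_assoc, Units.val_mk0, quadCharC_mul_self ha, one_mul]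
    rfl

/-- An element y has exactly χ(y) + 1 square roots. -/
theorem sum_comp_sq (hF : ringChar F ≠ 2) (f : F → ℂ) :
    ∑ x, f (x ^ 2) = ∑ y, (quadCharC F y + 1) * f y := by
  rw [← Finset.sum_fiberwise_of_maps_to (g := fun x : F => x ^ 2) (t := Finset.univ) (by simp)]
  refine Finset.sum_congr rfl fun y _ => ?_
  have h := quadraticChar_card_sqrts hF y
  rw [Finset.sum_congr rfl (g := fun _ => f y)
    (fun x hx => by rw [(Finset.mem_filter.mp hx).2]), Finset.sum_const, nsmul_eq_mul]
  congr 1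
  rw [quadCharC_apply]
  have h2 : ({x : F | x ^ 2 = y} : Set F).toFinset = Finset.univ.filter fun x => x ^ 2 = y := by
    ext; simp
  rw [h2] at h
  exact_mod_cast h

/-- Completing the square removes the linear term. In the remaining sum of (χ(y) + 1) ψ(ay), the 1
contributes a full character sum, which vanishes as a ≠ 0. -/
theorem sum_traceAddChar_quadratic (hF : ringChar F ≠ 2) {a : F} (ha : a ≠ 0) (b : F) :
    ∑ x, traceAddChar F (a * x ^ 2 + b * x) =
      quadCharC F a * quadGauss F * traceAddChar F (-(b ^ 2 / (4 * a))) := by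
  have h2 : (2 : F) ≠ 0 := Ring.two_ne_zero hF
  have h4 : (4 : F) ≠ 0 := by
    have : (4 : F) = 2 * 2 := by norm_num
    rw [this]; exact mul_ne_zero h2 h2
  rw [← (Equiv.subRight (b / (2 * a))).sum_comp]
  have h1 : ∀ x : F, traceAddChar F (a * (Equiv.subRight (b / (2 * a)) x) ^ 2
      + b * Equiv.subRight (b / (2 * a)) x) =
      traceAddChar F (a * x ^ 2) * traceAddChar F (-(b ^ 2 / (4 * a))) := by
    intro x
    rw [← AddChar.map_add_eq_mul]
    congr 1
    simp only [Equiv.subRight_apply]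
    field_simp
    ring
  simp_rw [h1]
  rw [← Finset.sum_mul, sum_comp_sq hF (fun y => traceAddChar F (a * y))]
  congr 1
  simp_rw [add_mul, one_mul]
  rw [Finset.sum_add_distrib, sum_quadCharC_mul_traceAddChar hF]
  have h3 := sum_traceAddChar_mul a
  simp_rw [mul_comm _ a] at h3
  rw [h3, if_neg ha, add_zero]

/-- The sum of the trace character over the square roots of `z`. -/
noncomputable def sqrtSum (z : F) : ℂ := ∑ w, if w ^ 2 = z then traceAddChar F w else 0

/-- Salié's evaluation. -/
theorem card_mul_sqrtSum (hF : ringChar F ≠ 2) (r : F) {m : F} (hm : m ≠ 0) :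
    (Fintype.card F : ℂ) * sqrtSum (m * r) = quadCharC F m * quadGauss F *
      ∑ a, quadCharC F a * traceAddChar F (-(a * r) - m / (4 * a)) := by
  -- The condition w² = mr is detected by summing ψ(b(w² - mr)) over b; the sum over w is then a
  -- quadratic Gauss sum.
  have h1 : (Fintype.card F : ℂ) * sqrtSum (m * r) =
      ∑ b, ∑ w, traceAddChar F (b * (w ^ 2 - m * r)) * traceAddChar F w := by
    rw [Finset.sum_comm, sqrtSum, Finset.mul_sum]
    refine Finset.sum_congr rfl fun w _ => ?_
    rw [← Finset.sum_mul, sum_traceAddChar_mul]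
    simp [sub_eq_zero]
  have h2 : ∀ b : F, ∑ w, traceAddChar F (b * (w ^ 2 - m * r)) * traceAddChar F w =
      quadGauss F * (quadCharC F b * traceAddChar F (-(b * (m * r)) - 1 / (4 * b))) := by
    intro b
    rcases eq_or_ne b 0 with rfl | hb
    · have := sum_traceAddChar_mul (1 : F)
      simp only [mul_one, one_ne_zero, if_false] at this
      simp [this, MulChar.map_zero]
    · have h3 : ∀ w : F, traceAddChar F (b * (w ^ 2 - m * r)) * traceAddChar F w =
          traceAddChar F (-(b * (m * r))) * traceAddChar F (b * w ^ 2 + 1 * w) := by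
        intro w
        rw [← AddChar.map_add_eq_mul, ← AddChar.map_add_eq_mul]
        congr 1
        ring
      simp_rw [h3]
      rw [← Finset.mul_sum, sum_traceAddChar_quadratic hF hb, sub_eq_add_neg,
        AddChar.map_add_eq_mul, one_pow]
      ring
  rw [h1, Finset.sum_congr rfl fun b _ => h2 b, ← Finset.mul_sum, mul_comm (quadCharC F m), mul_assoc]
  congr 1
  -- The substitution b = a/m produces the form that occurs in the transform of the sphere. At a = 0
  -- the division by zero is harmless because χ(0) = 0.
  rw [Finset.mul_sum, ← Equiv.sum_comp (Equiv.mulRight₀ m⁻¹ (inv_ne_zero hm))]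
  refine Finset.sum_congr rfl fun a _ => ?_
  rw [show Equiv.mulRight₀ m⁻¹ (inv_ne_zero hm) a = a * m⁻¹ from rfl, map_mul, quadCharC_inv]
  rcases eq_or_ne a 0 with rfl | ha
  · rw [MulChar.map_zero, zero_mul, zero_mul, zero_mul, mul_zero]
  · have h4 : -(a * m⁻¹ * (m * r)) - 1 / (4 * (a * m⁻¹)) = -(a * r) - m / (4 * a) := by
      rw [mul_assoc a, inv_mul_cancel_left₀ hm, one_div, mul_inv, mul_inv, inv_inv, div_eq_mul_inv,
        mul_inv]
      ring
    rw [h4]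
    ring

end CharacterSums

/-! ## The Fourier transform of a sphere -/

section SphereFourier

variable {F : Type} [Field F] [Fintype F] {d : ℕ}

/-- The Fourier transform of the indicator function of the sphere of radius `r`. -/
noncomputable def sphereFourier (r : F) (k : Fin d → F) : ℂ :=
  ∑ s ∈ radiusSphere d r, traceAddChar F (k ⬝ᵥ s)

theorem mem_radiusSphere {r : F} {x : Fin d → F} : x ∈ radiusSphere d r ↔ ∑ j, x j ^ 2 = r := by
  simp [radiusSphere]

theorem sphereFourier_zero (r : F) : sphereFourier r (0 : Fin d → F) = (radiusSphere d r).card := by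
  simp [sphereFourier]

/-- Once the equation of the sphere is detected by ψ(a(∑ x_j² - r)), the coordinates separate. -/
theorem card_mul_sphereFourier_eq_sum_prod (r : F) (k : Fin d → F) :
    (Fintype.card F : ℂ) * sphereFourier r k =
      ∑ a, traceAddChar F (-(a * r)) * ∏ j, ∑ x, traceAddChar F (a * x ^ 2 + k j * x) := by
  classical
  have h1 : (Fintype.card F : ℂ) * sphereFourier r k =
      ∑ a, ∑ x : Fin d → F, traceAddChar F (a * (∑ j, x j ^ 2 - r)) * traceAddChar F (k ⬝ᵥ x) := by
    rw [Finset.sum_comm, sphereFourier, radiusSphere, Finset.sum_filter, Finset.mul_sum]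
    refine Finset.sum_congr rfl fun x _ => ?_
    rw [← Finset.sum_mul, sum_traceAddChar_mul]
    simp [sub_eq_zero]
  rw [h1]
  refine Finset.sum_congr rfl fun a _ => ?_
  rw [Finset.prod_univ_sum, Fintype.piFinset_univ, Finset.mul_sum]
  refine Finset.sum_congr rfl fun x _ => ?_
  rw [← traceAddChar_sum, ← AddChar.map_add_eq_mul, ← AddChar.map_add_eq_mul]
  congr 1
  rw [Finset.sum_add_distrib, ← Finset.mul_sum, dotProduct]
  ring

variable [DecidableEq F]

/-- The term a = 0 gives the q^d at k = 0. For a ≠ 0 each coordinate contributes χ(a) G and a phase,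
and oddness of d reduces χ(a)^d to χ(a), leaving a Salié sum. -/
theorem card_mul_sphereFourier (hF : ringChar F ≠ 2) (hd : Odd d) (r : F) (k : Fin d → F) :
    (Fintype.card F : ℂ) * sphereFourier r k =
      (if k = 0 then (Fintype.card F : ℂ) ^ d else 0) + quadGauss F ^ d *
        ∑ a, quadCharC F a * traceAddChar F (-(a * r) - (k ⬝ᵥ k) / (4 * a)) := by
  rw [card_mul_sphereFourier_eq_sum_prod, Finset.mul_sum,
    ← Finset.add_sum_erase _ _ (Finset.mem_univ (0 : F)),
    ← Finset.add_sum_erase (a := (0 : F)) _ (fun a => quadGauss F ^ d * _) (Finset.mem_univ (0 : F))]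
  have h0 : traceAddChar F (-(0 * r)) * ∏ j, ∑ x, traceAddChar F (0 * x ^ 2 + k j * x) =
      if k = 0 then (Fintype.card F : ℂ) ^ d else 0 := by
    have : ∀ j, ∑ x, traceAddChar F (0 * x ^ 2 + k j * x) =
        if k j = 0 then (Fintype.card F : ℂ) else 0 := by
      intro j
      rw [← sum_traceAddChar_mul]
      simp [mul_comm]
    simp_rw [this]
    rw [zero_mul, neg_zero, AddChar.map_zero_eq_one, one_mul]
    split_ifs with h
    · simp [h]
    · obtain ⟨j, hj⟩ := Function.ne_iff.mp h
      exact Finset.prod_eq_zero (Finset.mem_univ j) (if_neg hj)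
  rw [h0, MulChar.map_zero, zero_mul, mul_zero, zero_add]
  congr 1
  refine Finset.sum_congr rfl fun a ha => ?_
  have ha : a ≠ 0 := Finset.ne_of_mem_erase ha
  simp_rw [sum_traceAddChar_quadratic hF ha]
  rw [Finset.prod_mul_distrib, Finset.prod_const, Finset.card_univ, Fintype.card_fin, mul_pow,
    quadCharC_pow hd, ← traceAddChar_sum, sub_eq_add_neg, AddChar.map_add_eq_mul,
    Finset.sum_neg_distrib, ← Finset.sum_div]
  simp_rw [sq, dotProduct]
  ring

theorem norm_sphereFourier_sq (hF : ringChar F ≠ 2) (hd : Odd d) (r : F) {k : Fin d → F}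
    (hk : k ⬝ᵥ k ≠ 0) :
    ‖sphereFourier r k‖ ^ 2 = (Fintype.card F : ℝ) ^ (d - 1) * ‖sqrtSum ((k ⬝ᵥ k) * r)‖ ^ 2 := by
  have hk0 : k ≠ 0 := by rintro rfl; simp at hk
  have h1 := card_mul_sphereFourier hF hd r k
  have h2 := card_mul_sqrtSum hF r hk
  rw [if_neg hk0, zero_add] at h1
  have hq : (Fintype.card F : ℂ) ≠ 0 := by simp
  -- The Salié sum is eliminated between the two evaluations by cross-multiplying; taking norms with
  -- |G|² = q finishes.
  have h3 : quadCharC F (k ⬝ᵥ k) * quadGauss F * sphereFourier r k =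
      quadGauss F ^ d * sqrtSum ((k ⬝ᵥ k) * r) := by
    apply mul_left_cancel₀ hq
    linear_combination quadCharC F (k ⬝ᵥ k) * quadGauss F * h1 - quadGauss F ^ d * h2
  have h4 := congrArg (fun z => ‖z‖ ^ 2) h3
  simp only [norm_mul, norm_pow, mul_pow, norm_quadCharC hk, one_mul] at h4
  rw [← pow_mul, mul_comm d 2, pow_mul, norm_quadGauss_sq hF] at h4
  obtain ⟨e, rfl⟩ := hd
  have hq' : (Fintype.card F : ℝ) ≠ 0 := by simp
  apply mul_left_cancel₀ hq'
  rw [h4, Nat.add_sub_cancel]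
  ring

/-! ### Cardinalities of spheres -/

theorem card_radiusSphere_zero (hF : ringChar F ≠ 2) (hd : Odd d) :
    ((radiusSphere d (0 : F)).card : ℝ) = (Fintype.card F : ℝ) ^ (d - 1) := by
  have h1 := card_mul_sphereFourier hF hd 0 (0 : Fin d → F)
  have h3 := MulChar.sum_eq_zero_of_ne_one (quadCharC_ne_one hF)
  simp only [sphereFourier_zero, if_true, dotProduct_zero, zero_div, sub_zero, mul_zero, neg_zero,
    AddChar.map_zero_eq_one, mul_one, h3, add_zero] at h1
  obtain ⟨e, rfl⟩ := hd
  have hq' : (Fintype.card F : ℝ) ≠ 0 := by simp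
  apply mul_left_cancel₀ hq'
  rw [Nat.add_sub_cancel, ← pow_succ']
  exact_mod_cast h1

/-- At k = 0 the Salié sum degenerates to a Gauss sum, so q times the deviation equals G^(d+1)
χ(-r). Squaring makes its sign irrelevant. -/
theorem card_radiusSphere_sub_sq (hF : ringChar F ≠ 2) (hd : Odd d) {r : F} (hr : r ≠ 0) :
    (((radiusSphere d r).card : ℝ) - (Fintype.card F : ℝ) ^ (d - 1)) ^ 2 =
      (Fintype.card F : ℝ) ^ (d - 1) := by
  have h1 := card_mul_sphereFourier hF hd r (0 : Fin d → F)
  have h2 := sum_quadCharC_mul_traceAddChar hF (-r)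
  have h3 : ∀ a : F, -(a * r) = -r * a := fun a => by ring
  simp only [sphereFourier_zero, if_true, dotProduct_zero, zero_div, sub_zero, h3, h2] at h1
  obtain ⟨e, rfl⟩ := hd
  have hq' : (Fintype.card F : ℝ) ^ 2 ≠ 0 := by simp
  apply mul_left_cancel₀ hq'
  have h4 : (((Fintype.card F : ℝ) * ((radiusSphere (2 * e + 1) r).card -
      (Fintype.card F : ℝ) ^ (2 * e) ) : ℝ) : ℂ) =
      quadGauss F ^ (2 * e + 2) * quadCharC F (-r) := by
    push_cast
    linear_combination h1
  have h5 := congrArg (fun z => ‖z‖ ^ 2) h4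
  simp only [norm_mul, norm_pow, mul_pow, norm_quadCharC (neg_ne_zero.mpr hr), mul_one,
    Complex.norm_real, Real.norm_eq_abs, sq_abs] at h5
  rw [← pow_mul ‖quadGauss F‖, mul_comm _ 2, pow_mul ‖quadGauss F‖, norm_quadGauss_sq hF] at h5
  rw [Nat.add_sub_cancel, h5]
  ring

end SphereFourier

/-! ## The Fourier sampling distribution -/

section FourierSamplingDistribution

variable {F : Type} [Field F] [Fintype F] {d : ℕ}

open scoped Classical in
theorem fourierMatrix_mulVec_translate (r : F) (k t : Fin d → F) :
    ∑ x, fourierMatrix F d k x * (if x - t ∈ radiusSphere d r then 1 else 0) =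
      ((1 / Real.sqrt ((Fintype.card F : ℝ) ^ d) : ℝ) : ℂ) * traceAddChar F (k ⬝ᵥ t) *
        sphereFourier r k := by
  rw [← Equiv.sum_comp (Equiv.addRight t)]
  simp only [Equiv.coe_addRight, add_sub_cancel_right, mul_ite, mul_one, mul_zero]
  rw [← Finset.sum_filter, Finset.filter_mem_eq_inter, Finset.univ_inter, sphereFourier,
    Finset.mul_sum]
  refine Finset.sum_congr rfl fun x _ => ?_
  rw [fourierMatrix, Matrix.of_apply, traceChar_eq, dotProduct_add, AddChar.map_add_eq_mul]
  ring

-- The centre enters only through a phase of modulus one, so averaging over centres does not change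
-- the measured distribution.
open scoped Classical in
theorem norm_fourierMatrix_mulVec_translate_sq (r : F) (k t : Fin d → F) :
    ‖∑ x, fourierMatrix F d k x * (if x - t ∈ radiusSphere d r then 1 else 0)‖ ^ 2 =
      ‖sphereFourier r k‖ ^ 2 / (Fintype.card F : ℝ) ^ d := by
  rw [fourierMatrix_mulVec_translate, norm_mul, norm_mul, norm_traceAddChar, Complex.norm_real,
    Real.norm_eq_abs, mul_one, mul_pow, sq_abs, div_pow, Real.sq_sqrt (by positivity)]
  ring

theorem fourierProb_eq (r : F) (k : Fin d → F) :
    fourierProb r k =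
      ‖sphereFourier r k‖ ^ 2 / ((Fintype.card F : ℝ) ^ d * (radiusSphere d r).card) := by
  classical
  have h1 : ∀ t : Fin d → F, (fourierMatrix F d).mulVec (sphereState r t) k =
      ((1 / Real.sqrt (radiusSphere d r).card : ℝ) : ℂ) *
        ∑ x, fourierMatrix F d k x * (if x - t ∈ radiusSphere d r then 1 else 0) := by
    intro t
    rw [Matrix.mulVec, dotProduct, Finset.mul_sum]
    refine Finset.sum_congr rfl fun x _ => ?_
    rw [sphereState]
    split_ifs <;> ring
  have h2 : (fourierMatrix F d * hiddenRadiusState d r * (fourierMatrix F d).conjTranspose) k k =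
      (1 / (Fintype.card F : ℂ) ^ d) *
        ∑ t : Fin d → F, (‖(fourierMatrix F d).mulVec (sphereState r t) k‖ ^ 2 : ℝ) := by
    rw [hiddenRadiusState, Matrix.mul_smul, Matrix.smul_mul, Matrix.smul_apply, smul_eq_mul,
      Finset.mul_sum, Finset.sum_mul, Matrix.sum_apply]
    congr 1
    rw [Complex.ofReal_sum]
    refine Finset.sum_congr rfl fun t _ => ?_
    rw [Matrix.mul_vecMulVec, Matrix.vecMulVec_mul, Matrix.vecMulVec_apply, ← Matrix.star_mulVec,
      Pi.star_apply, Complex.star_def, Complex.mul_conj, Complex.normSq_eq_norm_sq]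
  have h3 : ∀ t : Fin d → F, ‖(fourierMatrix F d).mulVec (sphereState r t) k‖ ^ 2 =
      ‖sphereFourier r k‖ ^ 2 / ((Fintype.card F : ℝ) ^ d * (radiusSphere d r).card) := by
    intro t
    rw [h1, norm_mul, mul_pow, norm_fourierMatrix_mulVec_translate_sq, Complex.norm_real,
      Real.norm_eq_abs, sq_abs, div_pow, Real.sq_sqrt (by positivity), one_pow, div_mul_div_comm,
      one_mul, mul_comm ((radiusSphere d r).card : ℝ)]
  rw [fourierProb, h2]
  simp_rw [h3]
  rw [Finset.sum_const, Finset.card_univ, Fintype.card_pi, Finset.prod_const, Finset.card_univ,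
    Fintype.card_fin]
  have hq : (Fintype.card F : ℝ) ^ d ≠ 0 := by simp
  have h4 : ((1 : ℂ) / (Fintype.card F : ℂ) ^ d) = ((1 / (Fintype.card F : ℝ) ^ d : ℝ) : ℂ) := by
    push_cast; rfl
  rw [h4, ← Complex.ofReal_mul, Complex.ofReal_re, nsmul_eq_mul]
  push_cast
  rw [← mul_assoc, one_div_mul_cancel hq, one_mul]

theorem fourierProb_nonneg (r : F) (k : Fin d → F) : 0 ≤ fourierProb r k := by
  rw [fourierProb_eq]; positivity

theorem fourierMatrix_mem_unitaryGroup [DecidableEq F] :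
    fourierMatrix F d ∈ Matrix.unitaryGroup (Fin d → F) ℂ := by
  rw [Matrix.mem_unitaryGroup_iff]
  ext k k'
  rw [Matrix.mul_apply]
  have h1 : ∀ x : Fin d → F, fourierMatrix F d k x * (star (fourierMatrix F d)) x k' =
      (1 / (Fintype.card F : ℂ) ^ d) * ∏ j, traceAddChar F (x j * (k - k') j) := by
    intro x
    rw [Matrix.star_apply, fourierMatrix, Matrix.of_apply, Matrix.of_apply, traceChar_eq,
      traceChar_eq, Complex.star_def, map_mul, Complex.conj_ofReal, ← AddChar.map_neg_eq_conj,
      mul_mul_mul_comm, ← Complex.ofReal_mul, ← AddChar.map_add_eq_mul, ← traceAddChar_sum,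
      div_mul_div_comm, one_mul, Real.mul_self_sqrt (by positivity)]
    push_cast
    congr 2
    rw [← sub_eq_add_neg, ← sub_dotProduct, dotProduct]
    exact Finset.sum_congr rfl fun j _ => mul_comm _ _
  simp_rw [h1]
  rw [← Finset.mul_sum, ← Fintype.piFinset_univ,
    ← Finset.prod_univ_sum (fun _ => Finset.univ) (fun j y => traceAddChar F (y * (k - k') j))]
  simp_rw [sum_traceAddChar_mul]
  rw [Matrix.one_apply]
  split_ifs with h
  · simp [h]
  · obtain ⟨j, hj⟩ := Function.ne_iff.mp h
    rw [Finset.prod_eq_zero (Finset.mem_univ j) (if_neg (sub_ne_zero.mpr hj)), mul_zero]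

theorem ringChar_ne_two_of_odd (hq : Odd (Fintype.card F)) : ringChar F ≠ 2 := by
  intro h
  have := FiniteField.even_card_of_char_two h
  rw [Nat.odd_iff] at hq
  omega

theorem three_le_card_of_odd (hq : Odd (Fintype.card F)) : 3 ≤ Fintype.card F := by
  have := Fintype.one_lt_card (α := F)
  obtain ⟨e, he⟩ := hq
  omega

/-! ### Sums over `k` grouped by the value of `k ⬝ᵥ k` -/

theorem card_radiusSphere_mul_sq (r : F) {u : F} (hu : u ≠ 0) :
    (radiusSphere d (r * u ^ 2)).card = (radiusSphere d r).card := by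
  refine Finset.card_nbij' (fun x => u⁻¹ • x) (fun x => u • x) ?_ ?_ ?_ ?_
  · intro x hx
    simp only [Finset.mem_coe, mem_radiusSphere, Pi.smul_apply, smul_eq_mul, mul_pow] at hx ⊢
    rw [← Finset.mul_sum, hx]
    field_simp
  · intro x hx
    simp only [Finset.mem_coe, mem_radiusSphere, Pi.smul_apply, smul_eq_mul, mul_pow] at hx ⊢
    rw [← Finset.mul_sum, hx, mul_comm]
  · intro x _; simp [smul_smul, hu]
  · intro x _; simp [smul_smul, hu]

theorem sum_comp_dotProduct_self [DecidableEq F] (f : F → ℝ) :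
    ∑ k : Fin d → F, f (k ⬝ᵥ k) = ∑ m, (radiusSphere d m).card * f m := by
  rw [← Finset.sum_fiberwise_of_maps_to (g := fun k : Fin d → F => k ⬝ᵥ k) (t := Finset.univ)
    (by simp)]
  refine Finset.sum_congr rfl fun m _ => ?_
  rw [Finset.sum_congr rfl (g := fun _ => f m)
    (fun x hx => by rw [(Finset.mem_filter.mp hx).2]), Finset.sum_const, nsmul_eq_mul]
  congr 3
  ext x
  rw [Finset.mem_filter, mem_radiusSphere]
  simp only [Finset.mem_univ, true_and, dotProduct, sq]

/-- Only the values of k·k in the square class of r are kept: their level sets all have the size of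
S_r, and u ↦ ru² is at most two-to-one, which costs the factor 1/2. -/
theorem half_sum_le_sum_comp_dotProduct_self [DecidableEq F] {f : F → ℝ} (hf : ∀ m, 0 ≤ f m)
    {r : F} (hr : r ≠ 0) :
    (radiusSphere d r).card / 2 * ∑ u ∈ Finset.univ.erase 0, f (r * u ^ 2) ≤
      ∑ k : Fin d → F, f (k ⬝ᵥ k) := by
  rw [sum_comp_dotProduct_self]
  have h1 : (radiusSphere d r).card * ∑ u ∈ Finset.univ.erase 0, f (r * u ^ 2) =
      ∑ u ∈ Finset.univ.erase 0, (radiusSphere d (r * u ^ 2)).card * f (r * u ^ 2) := by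
    rw [Finset.mul_sum]
    refine Finset.sum_congr rfl fun u hu => ?_
    rw [card_radiusSphere_mul_sq r (Finset.ne_of_mem_erase hu)]
  have h2 : ∑ u ∈ Finset.univ.erase 0, (radiusSphere d (r * u ^ 2)).card * f (r * u ^ 2) ≤
      2 * ∑ m, (radiusSphere d m).card * f m := by
    rw [← Finset.sum_fiberwise_of_maps_to (g := fun u : F => r * u ^ 2) (t := Finset.univ)
      (by simp), Finset.mul_sum]
    refine Finset.sum_le_sum fun m _ => ?_
    rw [Finset.sum_congr rfl (g := fun _ => (radiusSphere d m).card * f m)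
      (fun x hx => by rw [(Finset.mem_filter.mp hx).2]), Finset.sum_const, nsmul_eq_mul]
    refine mul_le_mul_of_nonneg_right ?_ (mul_nonneg (Nat.cast_nonneg _) (hf m))
    have h3 : (Finset.univ.filter fun u : F => u ^ 2 = m / r).card ≤ 2 := by
      by_cases h : ∃ v : F, v ^ 2 = m / r
      · obtain ⟨v, hv⟩ := h
        refine (Finset.card_le_card (t := {v, -v}) fun u hu => ?_).trans Finset.card_le_two
        simp only [Finset.mem_insert, Finset.mem_singleton]
        exact sq_eq_sq_iff_eq_or_eq_neg.mp ((Finset.mem_filter.mp hu).2.trans hv.symm)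
      · push Not at h
        simp [h]
    refine le_trans ?_ (Nat.cast_le.mpr h3 : (_ : ℝ) ≤ ((2 : ℕ) : ℝ)) |>.trans (by norm_num)
    refine Nat.cast_le.mpr (Finset.card_le_card fun u hu => ?_)
    simp only [Finset.mem_filter, Finset.mem_erase, Finset.mem_univ, true_and] at hu ⊢
    rw [← hu.2, mul_div_cancel_left₀ _ hr]
  linarith

/-! ### Cosines -/

/-- The real part of the trace character. -/
noncomputable def traceCos (a : F) : ℝ := (traceAddChar F a).re

theorem two_mul_traceCos_mul (u v : F) :
    2 * (traceCos u * traceCos v) = traceCos (u + v) + traceCos (u - v) := by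
  rw [traceCos, traceCos, traceCos, traceCos, sub_eq_add_neg, AddChar.map_add_eq_mul,
    AddChar.map_add_eq_mul, AddChar.map_neg_eq_conj]
  simp
  ring

theorem traceCos_zero : traceCos (0 : F) = 1 := by simp [traceCos]

theorem abs_traceCos_le_one (a : F) : |traceCos a| ≤ 1 :=
  (Complex.abs_re_le_norm _).trans (norm_traceAddChar a).le

theorem sum_traceCos_mul [DecidableEq F] (t : F) :
    ∑ u, traceCos (t * u) = if t = 0 then (Fintype.card F : ℝ) else 0 := by
  have h := congrArg Complex.re (sum_traceAddChar_mul t)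
  rw [Complex.re_sum] at h
  simp_rw [mul_comm _ t] at h
  rw [show ∑ u, traceCos (t * u) = _ from h]
  split_ifs <;> simp

theorem sum_traceCos_mul_mul_traceCos_mul [DecidableEq F] (s t : F) :
    ∑ u, traceCos (s * u) * traceCos (t * u) =
      ((if s + t = 0 then (Fintype.card F : ℝ) else 0) +
        (if s - t = 0 then (Fintype.card F : ℝ) else 0)) / 2 := by
  rw [← sum_traceCos_mul, ← sum_traceCos_mul, eq_div_iff two_ne_zero, mul_comm, Finset.mul_sum,
    ← Finset.sum_add_distrib]
  refine Finset.sum_congr rfl fun u _ => ?_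
  rw [two_mul_traceCos_mul, add_mul, sub_mul]

variable [DecidableEq F]

/-- The roots v and -v are distinct and their characters add up to 2 cos v; then 4 cos² v = 2 + 2
cos 2v. -/
theorem sqrtSum_sq (hF : ringChar F ≠ 2) {v : F} (hv : v ≠ 0) :
    ‖sqrtSum (v ^ 2)‖ ^ 2 = 2 + 2 * traceCos (2 * v) := by
  have hne : v ≠ -v := fun h => hv (by
    have h2 : 2 * v = 0 := by linear_combination h
    exact (mul_eq_zero.mp h2).resolve_left (Ring.two_ne_zero hF))
  have h1 : sqrtSum (v ^ 2) = ((2 * traceCos v : ℝ) : ℂ) := by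
    rw [sqrtSum, ← Finset.sum_filter]
    have h2 : (Finset.univ.filter fun w : F => w ^ 2 = v ^ 2) = {v, -v} := by
      ext w
      simp [sq_eq_sq_iff_eq_or_eq_neg]
    rw [h2, Finset.sum_pair hne, AddChar.map_neg_eq_conj, Complex.add_conj]
    rfl
  have h3 := two_mul_traceCos_mul v v
  rw [sub_self, traceCos_zero, ← two_mul] at h3
  rw [h1, Complex.norm_real, Real.norm_eq_abs, sq_abs]
  linarith

theorem sqrtSum_of_not_isSquare {z : F} (hz : ¬ IsSquare z) : sqrtSum z = 0 := by
  refine Finset.sum_eq_zero fun w _ => if_neg fun h => hz ⟨w, ?_⟩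
  rw [← h, sq]

/-- Zero has a single root, so the value is 1 and not the 2 that v = 0 would give in 2 cos v. -/
theorem sqrtSum_zero : sqrtSum (0 : F) = 1 := by simp [sqrtSum]

theorem fourierProb_eq_sqrtSum (hF : ringChar F ≠ 2) (hd : Odd d) (r : F) {k : Fin d → F}
    (hk : k ⬝ᵥ k ≠ 0) :
    fourierProb r k =
      ‖sqrtSum ((k ⬝ᵥ k) * r)‖ ^ 2 / (Fintype.card F * (radiusSphere d r).card) := by
  rw [fourierProb_eq, norm_sphereFourier_sq hF hd r hk]
  obtain ⟨e, rfl⟩ := hd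
  rw [Nat.add_sub_cancel, pow_succ _ (2 * e), mul_assoc (_ ^ (2 * e)),
    mul_div_mul_left _ _ (by simp)]

end FourierSamplingDistribution

/-! ## Total variation distances -/

section TotalVariation

variable {F : Type} [Field F] [Fintype F] {d : ℕ}

theorem fourierTV_comm (r r' : F) : fourierTV d r r' = fourierTV d r' r := by
  simp only [fourierTV, abs_sub_comm]

theorem eq_one_or_three_le_of_odd (hd : Odd d) : d = 1 ∨ 3 ≤ d := by
  obtain ⟨e, rfl⟩ := hd; omega

theorem card_radiusSphere_one [DecidableEq F] (hF : ringChar F ≠ 2) {r : F} (hr : r ≠ 0)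
    (h : (radiusSphere 1 r).Nonempty) : ((radiusSphere 1 r).card : ℝ) = 2 := by
  have h1 := card_radiusSphere_sub_sq hF (d := 1) odd_one hr
  have h2 : (0 : ℝ) < (radiusSphere 1 r).card := by exact_mod_cast h.card_pos
  rw [Nat.sub_self, pow_zero] at h1
  have h3 : ((radiusSphere 1 r).card : ℝ) * ((radiusSphere 1 r).card - 2) = 0 := by
    linear_combination h1
  rcases mul_eq_zero.mp h3 with h4 | h4 <;> linarith

/-- For r ≠ 0 the deviation is the square root of q^(d-1), and q^(d-1) ≥ 9 makes this at most a
third of q^(d-1). -/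
theorem card_radiusSphere_ge [DecidableEq F] (hq : Odd (Fintype.card F)) (hd : Odd d)
    (hd3 : 3 ≤ d) (r : F) :
    2 / 3 * (Fintype.card F : ℝ) ^ (d - 1) ≤ (radiusSphere d r).card := by
  have hF := ringChar_ne_two_of_odd hq
  rcases eq_or_ne r 0 with rfl | hr
  · rw [card_radiusSphere_zero hF hd]
    have : (0 : ℝ) ≤ (Fintype.card F : ℝ) ^ (d - 1) := by positivity
    linarith
  · have h1 := card_radiusSphere_sub_sq hF hd hr
    have h3 : (3 : ℝ) ≤ Fintype.card F := by exact_mod_cast three_le_card_of_odd hq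
    have h9 : (9 : ℝ) ≤ (Fintype.card F : ℝ) ^ (d - 1) :=
      calc (9 : ℝ) = 3 ^ 2 := by norm_num
        _ ≤ (Fintype.card F : ℝ) ^ 2 := by gcongr
        _ ≤ _ := pow_le_pow_right₀ (by linarith) (by omega)
    have h4 : |((radiusSphere d r).card : ℝ) - (Fintype.card F : ℝ) ^ (d - 1)| ≤
        1 / 3 * (Fintype.card F : ℝ) ^ (d - 1) := by
      apply abs_le_of_sq_le_sq _ (by positivity)
      rw [h1]
      nlinarith
    have := (abs_le.mp h4).1
    linarith

theorem card_radiusSphere_ge_of_nonempty (hq : Odd (Fintype.card F)) (hd : Odd d)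
    {r : F} (h : (radiusSphere d r).Nonempty) :
    2 / 3 * (Fintype.card F : ℝ) ^ (d - 1) ≤ (radiusSphere d r).card := by
  classical
  rcases eq_one_or_three_le_of_odd hd with rfl | hd3
  · have : (1 : ℝ) ≤ (radiusSphere 1 r).card := by exact_mod_cast h.card_pos
    norm_num
    linarith
  · exact card_radiusSphere_ge hq hd hd3 r

variable [DecidableEq F]

/-- Common starting point of the lower bounds: keep only k·k = ru² with u ≠ 0, where radius r has
probability (2 + 2 cos 2ru)/(q|S_r|). The constant 1/(4q) collects the 1/2 of the distance, the 1/2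
of the two-to-one map and the 1/q of the probability. -/
theorem sum_le_fourierTV (hF : ringChar F ≠ 2) (hd : Odd d) {r : F} (r' : F)
    (hr : r ≠ 0) (h : (radiusSphere d r).Nonempty) :
    1 / (4 * Fintype.card F) * ∑ u ∈ Finset.univ.erase 0, |2 + 2 * traceCos (2 * r * u) -
      (radiusSphere d r).card / (radiusSphere d r').card * ‖sqrtSum (r * u ^ 2 * r')‖ ^ 2| ≤
      fourierTV d r r' := by
  have hN : (0 : ℝ) < (radiusSphere d r).card := by exact_mod_cast h.card_pos
  have hq : (0 : ℝ) < Fintype.card F := by exact_mod_cast Fintype.card_pos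
  -- Vectors with k·k = 0 are discarded, since the closed form needs k·k ≠ 0.
  let f : F → ℝ := fun m => if m = 0 then 0 else
    |‖sqrtSum (m * r)‖ ^ 2 / (Fintype.card F * (radiusSphere d r).card) -
      ‖sqrtSum (m * r')‖ ^ 2 / (Fintype.card F * (radiusSphere d r').card)|
  have hf : ∀ m, 0 ≤ f m := by
    intro m
    simp only [f]
    split_ifs
    · rfl
    · positivity
  have h1 : ∑ k : Fin d → F, f (k ⬝ᵥ k) ≤ ∑ k : Fin d → F, |fourierProb r k - fourierProb r' k| := by
    refine Finset.sum_le_sum fun k _ => ?_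
    simp only [f]
    split_ifs with hk
    · positivity
    · rw [fourierProb_eq_sqrtSum hF hd r hk, fourierProb_eq_sqrtSum hF hd r' hk]
  have h2 := half_sum_le_sum_comp_dotProduct_self (d := d) hf hr
  have h3 : ∀ u ∈ Finset.univ.erase 0, |2 + 2 * traceCos (2 * r * u) -
      (radiusSphere d r).card / (radiusSphere d r').card * ‖sqrtSum (r * u ^ 2 * r')‖ ^ 2| =
      (Fintype.card F * (radiusSphere d r).card) * f (r * u ^ 2) := by
    intro u hu
    have hu : u ≠ 0 := Finset.ne_of_mem_erase hu
    simp only [f]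
    rw [if_neg (mul_ne_zero hr (pow_ne_zero 2 hu)), show r * u ^ 2 * r = (r * u) ^ 2 by ring,
      sqrtSum_sq hF (mul_ne_zero hr hu), ← mul_assoc]
    refine Eq.trans ?_ (congrArg (· * _) (abs_of_pos (mul_pos hq hN)))
    rw [← abs_mul]
    congr 1
    rw [mul_sub, mul_div_cancel₀ _ (mul_pos hq hN).ne', mul_div_assoc', mul_assoc (Fintype.card F : ℝ),
      mul_div_mul_left _ _ hq.ne', div_mul_eq_mul_div]
  rw [Finset.sum_congr rfl h3, ← Finset.mul_sum, fourierTV]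
  have h4 : 1 / (4 * (Fintype.card F : ℝ)) * (Fintype.card F * (radiusSphere d r).card *
      ∑ u ∈ Finset.univ.erase 0, f (r * u ^ 2)) = 1 / 2 * ((radiusSphere d r).card / 2 *
      ∑ u ∈ Finset.univ.erase 0, f (r * u ^ 2)) := by
    field_simp
    ring
  rw [h4]
  linarith

theorem exists_eq_mul_sq_of_quadraticChar_eq {r r' : F} (hr : r ≠ 0)
    (h : quadraticChar F r = quadraticChar F r') : ∃ t, t ≠ 0 ∧ r' = r * t ^ 2 := by
  have hr' : r' ≠ 0 := by
    rintro rfl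
    rw [quadraticChar_zero, quadraticChar_eq_zero_iff] at h
    exact hr h
  have h1 : quadraticChar F (r * r') = 1 := by
    rw [map_mul, ← h, ← sq, quadraticChar_sq_one hr]
  obtain ⟨v, hv⟩ := (quadraticChar_one_iff_isSquare (mul_ne_zero hr hr')).mp h1
  refine ⟨v / r, div_ne_zero ?_ hr, ?_⟩
  · rintro rfl
    exact mul_ne_zero hr hr' (by simpa using hv)
  · field_simp
    linear_combination hv

/-- With r' = rt² the two spheres have equal size, so the normalizations cancel and 2|cos α - cos β|
remains. This is at least (cos α - cos β)² because cosines differ by at most 2, and by orthogonality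
these squares sum to q. -/
theorem fourierTV_ge_of_quadraticChar_eq (hq : Odd (Fintype.card F)) (hd : Odd d) {r r' : F}
    (h : (radiusSphere d r).Nonempty) (hne : r ≠ r')
    (hχ : quadraticChar F r = quadraticChar F r') : 1 / 4 ≤ fourierTV d r r' := by
  have hF := ringChar_ne_two_of_odd hq
  have hr : r ≠ 0 := by
    rintro rfl
    rw [quadraticChar_zero, eq_comm, quadraticChar_eq_zero_iff] at hχ
    exact hne hχ.symm
  obtain ⟨t, ht, rfl⟩ := exists_eq_mul_sq_of_quadraticChar_eq hr hχ
  have h2 : (2 : F) ≠ 0 := Ring.two_ne_zero hF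
  have hN : (0 : ℝ) < (radiusSphere d r).card := by exact_mod_cast h.card_pos
  have hq : (0 : ℝ) < Fintype.card F := by exact_mod_cast Fintype.card_pos
  refine le_trans ?_ (sum_le_fourierTV hF hd (r * t ^ 2) hr h)
  have h3 : ∀ u ∈ Finset.univ.erase 0, (traceCos (2 * r * u) - traceCos (2 * r * t * u)) ^ 2 ≤
      |2 + 2 * traceCos (2 * r * u) - (radiusSphere d r).card /
        (radiusSphere d (r * t ^ 2)).card * ‖sqrtSum (r * u ^ 2 * (r * t ^ 2))‖ ^ 2| := by
    intro u hu
    have hu : u ≠ 0 := Finset.ne_of_mem_erase hu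
    rw [card_radiusSphere_mul_sq r ht, div_self hN.ne', one_mul,
      show r * u ^ 2 * (r * t ^ 2) = (r * t * u) ^ 2 by ring,
      sqrtSum_sq hF (mul_ne_zero (mul_ne_zero hr ht) hu),
      show 2 + 2 * traceCos (2 * r * u) - (2 + 2 * traceCos (2 * (r * t * u))) =
        2 * (traceCos (2 * r * u) - traceCos (2 * r * t * u)) by ring_nf, abs_mul, ← sq_abs, sq,
      abs_two]
    refine mul_le_mul_of_nonneg_right ?_ (abs_nonneg _)
    refine (abs_sub _ _).trans ?_
    linarith [abs_traceCos_le_one (2 * r * u), abs_traceCos_le_one (2 * r * t * u)]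
  have h4 : ∑ u ∈ Finset.univ.erase 0, (traceCos (2 * r * u) - traceCos (2 * r * t * u)) ^ 2 =
      Fintype.card F := by
    -- The term u = 0 is (1 - 1)² = 0, so it can be restored.
    rw [Finset.sum_erase _ (by simp)]
    have h5 : ∀ u : F, (traceCos (2 * r * u) - traceCos (2 * r * t * u)) ^ 2 =
        traceCos (2 * r * u) * traceCos (2 * r * u) +
          traceCos (2 * r * t * u) * traceCos (2 * r * t * u) -
          2 * (traceCos (2 * r * u) * traceCos (2 * r * t * u)) := fun u => by ring
    simp_rw [h5]
    rw [Finset.sum_sub_distrib, Finset.sum_add_distrib, ← Finset.mul_sum]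
    simp_rw [sum_traceCos_mul_mul_traceCos_mul]
    have h6 : ∀ s : F, s ≠ 0 → s + s ≠ 0 := fun s hs => by
      rw [← two_mul]; exact mul_ne_zero h2 hs
    have h7 : 2 * r ≠ 0 := mul_ne_zero h2 hr
    -- The cross terms vanish unless t = ±1, and t = ±1 would mean r' = r.
    have h8 : 2 * r + 2 * r * t ≠ 0 := by
      intro h0
      have : t = -1 := by
        apply mul_left_cancel₀ h7
        linear_combination h0
      apply hne
      rw [this]; ring
    have h9 : 2 * r - 2 * r * t ≠ 0 := by
      intro h0
      have : t = 1 := by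
        apply mul_left_cancel₀ h7
        linear_combination -h0
      apply hne
      rw [this]; ring
    rw [if_neg (h6 _ h7), if_neg (h6 _ (mul_ne_zero h7 ht)), if_neg h8, if_neg h9, sub_self,
      sub_self, if_pos rfl]
    ring
  have h5 := Finset.sum_le_sum h3
  rw [h4] at h5
  calc (1 : ℝ) / 4 = 1 / (4 * Fintype.card F) * Fintype.card F := by field_simp
    _ ≤ _ := by gcongr

theorem sum_erase_traceCos (hF : ringChar F ≠ 2) {r : F} (hr : r ≠ 0) :
    ∑ u ∈ Finset.univ.erase 0, traceCos (2 * r * u) = -1 := by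
  have h1 := sum_traceCos_mul (2 * r)
  rw [if_neg (mul_ne_zero (Ring.two_ne_zero hF) hr),
    ← Finset.add_sum_erase _ _ (Finset.mem_univ (0 : F)), mul_zero, traceCos_zero] at h1
  linarith

theorem sum_erase_traceCos_sq (hF : ringChar F ≠ 2) {r : F} (hr : r ≠ 0) :
    ∑ u ∈ Finset.univ.erase 0, traceCos (2 * r * u) ^ 2 = (Fintype.card F : ℝ) / 2 - 1 := by
  have h2 := Ring.two_ne_zero hF
  have h1 := sum_traceCos_mul_mul_traceCos_mul (2 * r) (2 * r)
  simp_rw [← sq] at h1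
  rw [if_neg (by rw [← two_mul]; exact mul_ne_zero h2 (mul_ne_zero h2 hr)), sub_self, if_pos rfl,
    ← Finset.add_sum_erase _ _ (Finset.mem_univ (0 : F)), mul_zero, traceCos_zero] at h1
  linarith

/-- Here rr' is a nonsquare, so r' has probability zero wherever k·k = ru² with u ≠ 0, and all the
mass of r there counts. -/
theorem fourierTV_ge_of_quadraticChar_ne (hq : Odd (Fintype.card F)) (hd : Odd d) {r r' : F}
    (h : (radiusSphere d r).Nonempty) (hr : r ≠ 0) (hr' : r' ≠ 0)
    (hχ : quadraticChar F r ≠ quadraticChar F r') : 1 / 12 ≤ fourierTV d r r' := by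
  have hF := ringChar_ne_two_of_odd hq
  have hq3 : (3 : ℝ) ≤ Fintype.card F := by exact_mod_cast three_le_card_of_odd hq
  refine le_trans ?_ (sum_le_fourierTV hF hd r' hr h)
  have h3 : ∀ u ∈ Finset.univ.erase 0, 2 + 2 * traceCos (2 * r * u) ≤
      |2 + 2 * traceCos (2 * r * u) - (radiusSphere d r).card /
        (radiusSphere d r').card * ‖sqrtSum (r * u ^ 2 * r')‖ ^ 2| := by
    intro u hu
    have hu : u ≠ 0 := Finset.ne_of_mem_erase hu
    rw [sqrtSum_of_not_isSquare]
    · simpa using le_abs_self _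
    · rintro hs
      rw [← quadraticChar_one_iff_isSquare (mul_ne_zero (mul_ne_zero hr (pow_ne_zero 2 hu)) hr'),
        map_mul, map_mul, quadraticChar_sq_one' hu, mul_one] at hs
      apply hχ
      rcases quadraticChar_dichotomy hr with h1 | h1 <;>
        rcases quadraticChar_dichotomy hr' with h2 | h2 <;> rw [h1, h2] at hs ⊢ <;> norm_num at hs
  have h5 := Finset.sum_le_sum h3
  rw [Finset.sum_add_distrib, ← Finset.mul_sum, sum_erase_traceCos hF hr, Finset.sum_const,
    Finset.card_erase_of_mem (Finset.mem_univ _), Finset.card_univ, nsmul_eq_mul,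
    Nat.cast_sub Fintype.card_pos, Nat.cast_one] at h5
  calc (1 : ℝ) / 12 ≤ 1 / (4 * Fintype.card F) * ((Fintype.card F - 1) * 2 + 2 * -1) := by
        rw [div_mul_eq_mul_div, div_le_div_iff₀ (by norm_num) (by linarith)]
        linarith
    _ ≤ _ := by gcongr

/-- The terms 1 - χ(mr) sum to q, and each is 2 at a nonsquare, 0 at a nonzero square and 1 at m =
0. -/
theorem card_sub_one_le_two_mul_card_nonsquare (hF : ringChar F ≠ 2) {r : F} (hr : r ≠ 0) :
    (Fintype.card F : ℤ) - 1 ≤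
      2 * (Finset.univ.filter fun m : F => quadraticChar F (m * r) = -1).card := by
  have h1 := quadraticChar_sum_zero hF
  rw [← Equiv.sum_comp (Equiv.mulRight₀ r hr)] at h1
  have h2 : ∑ m : F, (1 - quadraticChar F (m * r)) ≤
      ∑ m : F, ((if m = 0 then 1 else 0) + if quadraticChar F (m * r) = -1 then 2 else 0) := by
    refine Finset.sum_le_sum fun m _ => ?_
    rcases eq_or_ne m 0 with rfl | hm
    · simp
    · rw [if_neg hm]
      rcases quadraticChar_dichotomy (mul_ne_zero hm hr) with h | h <;> rw [h] <;> norm_num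
  rw [Finset.sum_sub_distrib, show ∑ m : F, quadraticChar F (m * r) = 0 from h1,
    Finset.sum_add_distrib, Finset.sum_ite_eq' Finset.univ (0 : F), ← Finset.sum_filter,
    Finset.sum_const, Finset.sum_const] at h2
  simp only [Finset.mem_univ, if_true, Finset.card_univ, nsmul_eq_mul, mul_one, sub_zero] at h2
  linarith

/-- For d ≥ 3, vectors with (k·k)r a nonsquare have probability 0 under r and q^(-d) under 0, and
they are numerous. In dimension 1 there are none, because a nonempty S_r forces r to be a square.
There |S_r| = 2 and |S_0| = 1, so the difference is 2|cos| ≥ 2 cos², giving (q - 2)/(4q), which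
equals 1/12 at q = 3. -/
theorem fourierTV_zero_ge (hq : Odd (Fintype.card F)) (hd : Odd d) {r : F}
    (h : (radiusSphere d r).Nonempty) (hr : r ≠ 0) : 1 / 12 ≤ fourierTV d r 0 := by
  have hF := ringChar_ne_two_of_odd hq
  have hq3 : (3 : ℝ) ≤ Fintype.card F := by exact_mod_cast three_le_card_of_odd hq
  have hq0 : (0 : ℝ) < Fintype.card F := by linarith
  rcases eq_one_or_three_le_of_odd hd with rfl | hd3
  · refine le_trans ?_ (sum_le_fourierTV hF hd 0 hr h)
    have h3 : ∀ u ∈ Finset.univ.erase 0, 2 * traceCos (2 * r * u) ^ 2 ≤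
        |2 + 2 * traceCos (2 * r * u) - (radiusSphere 1 r).card /
          (radiusSphere 1 (0 : F)).card * ‖sqrtSum (r * u ^ 2 * 0)‖ ^ 2| := by
      intro u _
      rw [card_radiusSphere_one hF hr h, card_radiusSphere_zero hF odd_one, mul_zero, sqrtSum_zero]
      norm_num
      rw [← sq_abs]
      nlinarith [abs_traceCos_le_one (2 * r * u), abs_nonneg (traceCos (2 * r * u))]
    have h5 := Finset.sum_le_sum h3
    rw [← Finset.mul_sum, sum_erase_traceCos_sq hF hr] at h5
    calc (1 : ℝ) / 12 ≤ 1 / (4 * Fintype.card F) * (2 * (Fintype.card F / 2 - 1)) := by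
          rw [div_mul_eq_mul_div, div_le_div_iff₀ (by norm_num) (by linarith)]
          linarith
      _ ≤ _ := by gcongr
  · let f : F → ℝ := fun m => if quadraticChar F (m * r) = -1 then
      1 / (Fintype.card F : ℝ) ^ d else 0
    have h1 : ∑ k : Fin d → F, f (k ⬝ᵥ k) ≤
        ∑ k : Fin d → F, |fourierProb r k - fourierProb 0 k| := by
      refine Finset.sum_le_sum fun k _ => ?_
      simp only [f]
      split_ifs with hk
      · have hk0 : k ⬝ᵥ k ≠ 0 := by
          intro h0; rw [h0, zero_mul, quadraticChar_zero] at hk; norm_num at hk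
        rw [fourierProb_eq_sqrtSum hF hd r hk0, fourierProb_eq_sqrtSum hF hd 0 hk0, mul_zero,
          sqrtSum_zero, sqrtSum_of_not_isSquare (quadraticChar_neg_one_iff_not_isSquare.mp hk),
          card_radiusSphere_zero hF hd, ← pow_succ', Nat.sub_add_cancel (by omega), norm_zero,
          norm_one, abs_sub_comm]
        simp
      · positivity
    have h2 : ∑ m : F, 2 / (3 * (Fintype.card F : ℝ)) * (if quadraticChar F (m * r) = -1 then 1 else 0) ≤
        ∑ m, (radiusSphere d m).card * f m := by
      refine Finset.sum_le_sum fun m _ => ?_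
      simp only [f]
      split_ifs
      · have := card_radiusSphere_ge hq hd hd3 m
        rw [mul_one, mul_one_div, div_le_div_iff₀ (by positivity) (by positivity)]
        calc 2 * (Fintype.card F : ℝ) ^ d =
            2 / 3 * (Fintype.card F : ℝ) ^ (d - 1) * (3 * Fintype.card F) := by
              obtain ⟨e, rfl⟩ := hd
              rw [Nat.add_sub_cancel]; ring
          _ ≤ _ := by gcongr
      · simp
    rw [sum_comp_dotProduct_self] at h1
    rw [← Finset.mul_sum, Finset.sum_boole] at h2
    have h4 : (Fintype.card F : ℝ) - 1 ≤
        2 * (Finset.univ.filter fun m : F => quadraticChar F (m * r) = -1).card := by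
      exact_mod_cast card_sub_one_le_two_mul_card_nonsquare hF hr
    have h5 : (2 : ℝ) / 9 ≤ 2 / (3 * Fintype.card F) *
        (Finset.univ.filter fun m : F => quadraticChar F (m * r) = -1).card := by
      rw [div_mul_eq_mul_div, div_le_div_iff₀ (by norm_num) (by positivity)]
      linarith
    rw [fourierTV]
    linarith

end TotalVariation

theorem fourierTV_ge {F : Type} [Field F] [Fintype F] {d : ℕ} (hq : Odd (Fintype.card F)) (hd : Odd d) {r r' : F}
    (h : (radiusSphere d r).Nonempty) (h' : (radiusSphere d r').Nonempty) (hne : r ≠ r') :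
    1 / 12 ≤ fourierTV d r r' := by
  classical
  rcases eq_or_ne r 0 with rfl | hr
  · rw [fourierTV_comm]
    exact fourierTV_zero_ge hq hd h' hne.symm
  rcases eq_or_ne r' 0 with rfl | hr'
  · exact fourierTV_zero_ge hq hd h hr
  by_cases hχ : quadraticChar F r = quadraticChar F r'
  · exact le_trans (by norm_num) (fourierTV_ge_of_quadraticChar_eq hq hd h hne hχ)
  · exact fourierTV_ge_of_quadraticChar_ne hq hd h hr hr' hχ

/-! ## Unitaries -/

section Unitaries

variable {ι : Type*} [Fintype ι] [DecidableEq ι]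

theorem sum_norm_mulVec_sq {U : Matrix ι ι ℂ} (hU : U ∈ Matrix.unitaryGroup ι ℂ) (ψ : ι → ℂ) :
    ∑ i, ‖U.mulVec ψ i‖ ^ 2 = ∑ i, ‖ψ i‖ ^ 2 := by
  have h : ∀ v : ι → ℂ, ((∑ i, ‖v i‖ ^ 2 : ℝ) : ℂ) = star v ⬝ᵥ v := by
    intro v
    rw [dotProduct, Complex.ofReal_sum]
    refine Finset.sum_congr rfl fun i _ => ?_
    rw [Pi.star_apply, Complex.star_def, mul_comm, Complex.mul_conj, Complex.normSq_eq_norm_sq]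
  apply Complex.ofReal_injective
  rw [h, h, Matrix.star_mulVec, Matrix.dotProduct_mulVec, Matrix.vecMul_vecMul,
    ← Matrix.star_eq_conjTranspose, Matrix.mem_unitaryGroup_iff'.mp hU, Matrix.vecMul_one]

/-- The unitary permuting the computational basis. -/
def permUnitary (e : Equiv.Perm ι) : Matrix.unitaryGroup ι ℂ :=
  ⟨(1 : Matrix ι ι ℂ).submatrix e id, by
    rw [Matrix.mem_unitaryGroup_iff, Matrix.star_eq_conjTranspose, Matrix.conjTranspose_submatrix,
      Matrix.conjTranspose_one]
    simpa using Matrix.submatrix_mul_equiv (1 : Matrix ι ι ℂ) 1 e (Equiv.refl ι) e⟩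

/-- Amplitudes are composed with e, not its inverse; the permutations used below are involutions, so
the distinction disappears. -/
theorem permUnitary_mulVec (e : Equiv.Perm ι) (ψ : ι → ℂ) :
    (permUnitary e).1.mulVec ψ = ψ ∘ e := by
  ext i
  simp [permUnitary, Matrix.mulVec, dotProduct, Matrix.one_apply]

theorem exists_unitary_mulVec_single (i : ι) {v : ι → ℂ} (hv : ∑ j, ‖v j‖ ^ 2 = 1) :
    ∃ U : Matrix.unitaryGroup ι ℂ, U.1.mulVec (Pi.single i 1) = v := by
  -- Only the restriction of this constant family to {i} is extended to an orthonormal basis, which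
  -- places v at index i.
  let w : ι → EuclideanSpace ℂ ι := fun _ => WithLp.toLp 2 v
  have hw : ‖WithLp.toLp 2 v‖ = 1 := by
    rw [EuclideanSpace.norm_eq, Real.sqrt_eq_one]
    exact hv
  have ho : Orthonormal ℂ (Set.domRestrict {i} w) := by
    refine ⟨fun _ => hw, fun a b hab => (hab (Subsingleton.elim a b)).elim⟩
  obtain ⟨b, hb⟩ := ho.exists_orthonormalBasis_extension_of_card_eq (by simp)
  refine ⟨⟨(EuclideanSpace.basisFun ι ℂ).toBasis.toMatrix b,
    OrthonormalBasis.toMatrix_orthonormalBasis_mem_unitary _ _⟩, ?_⟩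
  ext j
  rw [Matrix.mulVec_single_one]
  simp [Module.Basis.toMatrix, hb i rfl, w]

end Unitaries

/-! ## The sampling algorithm -/

section SamplingAlgorithm

set_option synthInstance.maxSize 10000

variable {F : Type} [Fintype F] {d : ℕ} {A B : Type} {n : ℕ}

/-- The product of a state of the query registers and of states of `n` slots of work space. -/
noncomputable def prodState (g : (Fin d → F) × A × B → ℂ)
    (h : Fin n → (Fin d → F) × A × B → ℂ) :
    QReg F d A B (Fin n → (Fin d → F) × A × B) → ℂ :=
  fun z => g (z.1, z.2.1, z.2.2.1) * ∏ j, h j (z.2.2.2 j)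

/-- Exchange of the query registers with a slot of the work space. -/
def slotSwap (i : Fin n) : Equiv.Perm (QReg F d A B (Fin n → (Fin d → F) × A × B)) :=
  Function.Involutive.toPerm
    (fun z => ((z.2.2.2 i).1, (z.2.2.2 i).2.1, (z.2.2.2 i).2.2,
      Function.update z.2.2.2 i (z.1, z.2.1, z.2.2.1)))
    (fun z => by simp)

-- Swapping preserves product states: it stores a finished sample in slot i and loads the former
-- content of that slot into the query registers.
omit [Fintype F] in
theorem prodState_comp_slotSwap (g : (Fin d → F) × A × B → ℂ)
    (h : Fin n → (Fin d → F) × A × B → ℂ) (i : Fin n) :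
    prodState g h ∘ slotSwap i = prodState (h i) (Function.update h i g) := by
  ext z
  change g (z.2.2.2 i) * ∏ j, h j (Function.update z.2.2.2 i (z.1, z.2.1, z.2.2.1) j) =
    h i (z.1, z.2.1, z.2.2.1) * ∏ j, Function.update h i g j (z.2.2.2 j)
  rw [← Finset.mul_prod_erase _ _ (Finset.mem_univ i),
    ← Finset.mul_prod_erase _ (fun j => Function.update h i g j (z.2.2.2 j)) (Finset.mem_univ i),
    Function.update_self, Function.update_self]
  have h1 : ∀ j ∈ Finset.univ.erase i,
      h j (Function.update z.2.2.2 i (z.1, z.2.1, z.2.2.1) j) =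
        Function.update h i g j (z.2.2.2 j) := by
    intro j hj
    rw [Function.update_of_ne (Finset.ne_of_mem_erase hj),
      Function.update_of_ne (Finset.ne_of_mem_erase hj)]
  rw [Finset.prod_congr rfl h1]
  ring

theorem sum_norm_prodState_sq [Fintype A] [Fintype B] (g : (Fin d → F) × A × B → ℂ)
    (h : Fin n → (Fin d → F) × A × B → ℂ) (P : (Fin n → (Fin d → F) × A × B) → Prop)
    [DecidablePred P] :
    ∑ z, (if P z.2.2.2 then ‖prodState g h z‖ ^ 2 else 0) =
      (∑ y, ‖g y‖ ^ 2) * ∑ w, if P w then ∏ j, ‖h j (w j)‖ ^ 2 else 0 := by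
  simp only [Fintype.sum_prod_type (α₁ := Fin d → F), Fintype.sum_prod_type (α₁ := A),
    Fintype.sum_prod_type (α₁ := B), Finset.sum_mul]
  refine Finset.sum_congr rfl fun x _ => Finset.sum_congr rfl fun a _ =>
    Finset.sum_congr rfl fun b _ => ?_
  rw [Finset.mul_sum]
  refine Finset.sum_congr rfl fun w _ => ?_
  simp only [prodState, norm_mul, norm_prod, mul_pow, Finset.prod_pow, mul_ite, mul_zero]

theorem sum_norm_prodState_sq_eq_one [Fintype A] [Fintype B] {g : (Fin d → F) × A × B → ℂ}
    (hg : ∑ y, ‖g y‖ ^ 2 = 1) : ∑ z, ‖prodState g (fun _ : Fin n => g) z‖ ^ 2 = 1 := by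
  classical
  have h := sum_norm_prodState_sq g (fun _ : Fin n => g) (fun _ => True)
  simp only [if_true] at h
  rw [h, hg, one_mul, ← Fintype.piFinset_univ,
    ← Finset.prod_univ_sum (fun _ => Finset.univ) (fun _ y => ‖g y‖ ^ 2)]
  simp [hg]

variable [Field F]

/-- The Fourier transform of the point register. -/
noncomputable def pointFourier (g : (Fin d → F) × A × B → ℂ) : (Fin d → F) × A × B → ℂ :=
  fun y => ∑ x, fourierMatrix F d y.1 x * g (x, y.2)

variable [DecidableEq F] [Fintype A] [DecidableEq A] [Fintype B] [DecidableEq B]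

/-- The Fourier transform of the point register as a unitary of all registers. -/
noncomputable def pointFourierUnitary (F : Type) [Field F] [Fintype F] [DecidableEq F] (d : ℕ)
    (A B W : Type) [Fintype A] [DecidableEq A] [Fintype B] [DecidableEq B] [Fintype W]
    [DecidableEq W] : Matrix.unitaryGroup (QReg F d A B W) ℂ :=
  ⟨Matrix.kronecker (fourierMatrix F d) (1 : Matrix (A × B × W) (A × B × W) ℂ),
    Matrix.kronecker_mem_unitary fourierMatrix_mem_unitaryGroup (one_mem _)⟩

theorem pointFourierUnitary_mulVec {W : Type} [Fintype W] [DecidableEq W]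
    (ψ : QReg F d A B W → ℂ) (z : QReg F d A B W) :
    (pointFourierUnitary F d A B W).1.mulVec ψ z = ∑ x, fourierMatrix F d z.1 x * ψ (x, z.2) := by
  rw [Matrix.mulVec, dotProduct, Fintype.sum_prod_type]
  refine Finset.sum_congr rfl fun x _ => ?_
  simp [pointFourierUnitary, Matrix.kroneckerMap_apply, Matrix.one_apply]

variable [AddCommGroup A] [AddCommGroup B]

/-- The sign change of the offset register. -/
def offsetNeg (F : Type) (d : ℕ) (A B W : Type) [AddCommGroup A] :
    Equiv.Perm (QReg F d A B W) :=
  Function.Involutive.toPerm (fun z => (z.1, -z.2.1, z.2.2)) (fun z => by simp)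

/-- The uniform superposition over all points and offset labels. -/
noncomputable def uniformState (F : Type) [Fintype F] (d : ℕ) (A B : Type) [Fintype A]
    [AddCommGroup B] [DecidableEq B] : (Fin d → F) × A × B → ℂ :=
  fun y => if y.2.2 = 0 then
    ((1 / Real.sqrt ((Fintype.card F : ℝ) ^ d * Fintype.card A) : ℝ) : ℂ) else 0

/-- The state of the query registers after one round: a query to `f₁`, a sign change of the
offset label and a query to `f₋₁`. -/
noncomputable def roundState {r : F} (O : HiddenRadiusOracle F d A B r)
    (g : (Fin d → F) × A × B → ℂ) : (Fin d → F) × A × B → ℂ :=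
  fun y => g (y.1, O.bwd y.1 y.2.2 - y.2.1, y.2.2 - O.fwd y.1 (O.bwd y.1 y.2.2 - y.2.1))

omit [DecidableEq F] [DecidableEq A] in
theorem sum_norm_uniformState_sq : ∑ y, ‖uniformState F d A B y‖ ^ 2 = 1 := by
  simp only [Fintype.sum_prod_type, uniformState]
  have h1 : ∀ b : B, ‖if b = 0 then ((1 / Real.sqrt ((Fintype.card F : ℝ) ^ d *
      Fintype.card A) : ℝ) : ℂ) else 0‖ ^ 2 =
      if b = 0 then 1 / ((Fintype.card F : ℝ) ^ d * Fintype.card A) else 0 := by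
    intro b
    split_ifs
    · rw [Complex.norm_real, Real.norm_eq_abs, sq_abs, div_pow, Real.sq_sqrt (by positivity),
        one_pow]
    · simp
  have h2 : (Fintype.card A : ℝ) ≠ 0 := Nat.cast_ne_zero.mpr Fintype.card_ne_zero
  simp_rw [h1]
  simp

/-- One round of the algorithm, ending with the exchange of the query registers and a slot. -/
noncomputable def samplingRound (F : Type) [Field F] [Fintype F] [DecidableEq F] (d : ℕ)
    (A B : Type) [AddCommGroup A] [Fintype A] [DecidableEq A] [Fintype B] [DecidableEq B]
    {n : ℕ} (i : Fin n) :
    List (QueryKind × Matrix.unitaryGroup (QReg F d A B (Fin n → (Fin d → F) × A × B)) ℂ) :=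
  [(.fwd, permUnitary (offsetNeg F d A B _)),
    (.bwd, permUnitary (slotSwap i) * pointFourierUnitary F d A B _)]

/-- The sign change makes the second query cancel the offset label instead of doubling it, so the
label does not stay entangled with the point. -/
theorem foldl_samplingRound {r : F} (O : HiddenRadiusOracle F d A B r)
    (g : (Fin d → F) × A × B → ℂ) (h : Fin n → (Fin d → F) × A × B → ℂ) (i : Fin n) :
    (samplingRound F d A B i).foldl (fun ψ st => Matrix.mulVec st.2.1 (O.query st.1 ψ))
      (prodState g h) =
    prodState (h i) (Function.update h i (pointFourier (roundState O g))) := by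
  rw [← prodState_comp_slotSwap]
  simp only [samplingRound, List.foldl_cons, List.foldl_nil]
  rw [Submonoid.coe_mul, ← Matrix.mulVec_mulVec, permUnitary_mulVec, permUnitary_mulVec]
  congr 1
  ext ⟨x, a, b, w⟩
  rw [pointFourierUnitary_mulVec]
  simp only [prodState, pointFourier, Finset.sum_mul]
  refine Finset.sum_congr rfl fun x' _ => ?_
  rw [mul_assoc]
  congr 1
  change prodState g h (x', -(a - O.bwd x' b), b - O.fwd x' (-(a - O.bwd x' b)), w) = _
  rw [neg_sub]
  rfl

/-- Each unused slot holds a fresh copy of g, so every swap resets the query registers to g for the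
next round. `Nodup` ensures that no sample is loaded back. -/
theorem foldl_flatMap_samplingRound {r : F} (O : HiddenRadiusOracle F d A B r)
    (g : (Fin d → F) × A × B → ℂ) (l : List (Fin n)) (hl : l.Nodup)
    (h : Fin n → (Fin d → F) × A × B → ℂ) (hh : ∀ i ∈ l, h i = g) :
    (l.flatMap (samplingRound F d A B)).foldl
      (fun ψ st => Matrix.mulVec st.2.1 (O.query st.1 ψ)) (prodState g h) =
    prodState g (fun j => if j ∈ l then pointFourier (roundState O g) else h j) := by
  induction l generalizing h with
  | nil => simp
  | cons i l ih =>
    rw [List.flatMap_cons, List.foldl_append, foldl_samplingRound, hh i (by simp),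
      ih hl.of_cons]
    · congr 1
      ext j y
      by_cases hj : j = i
      · subst hj
        simp [(List.nodup_cons.mp hl).1]
      · simp [hj]
    · intro j hj
      rw [Function.update_of_ne, hh j (by simp [hj])]
      rintro rfl
      exact (List.nodup_cons.mp hl).1 hj

/-- The algorithm that collects `n` Fourier samples and applies `est` to them. -/
noncomputable def samplingAlgorithm (n : ℕ) (est : (Fin n → (Fin d → F) × A × B) → F) :
    QueryAlgorithm F d A B where
  W := Fin n → (Fin d → F) × A × B
  w₀ := fun _ => (0, 0, 0)
  -- A single unitary prepares n + 1 copies of `uniformState`, one in the query registers and one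
  -- per slot.
  first := (exists_unitary_mulVec_single (0, 0, 0, fun _ => (0, 0, 0))
    (sum_norm_prodState_sq_eq_one sum_norm_uniformState_sq)).choose
  steps := (List.finRange n).flatMap (samplingRound F d A B)
  output := fun z => est z.2.2.2

theorem numQueries_samplingAlgorithm (est : (Fin n → (Fin d → F) × A × B) → F) :
    (samplingAlgorithm n est).numQueries = 2 * n := by
  have h : ∀ i : Fin n, (samplingRound F d A B i).length = 2 := fun _ => rfl
  change ((List.finRange n).flatMap (samplingRound F d A B)).length = 2 * n
  rw [List.length_flatMap]
  simp [h, mul_comm]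

/-- The state of a slot that holds a Fourier sample. -/
noncomputable def sampleState {r : F} (O : HiddenRadiusOracle F d A B r) :
    (Fin d → F) × A × B → ℂ :=
  pointFourier (roundState O (uniformState F d A B))

theorem finalState_samplingAlgorithm {r : F} (O : HiddenRadiusOracle F d A B r)
    (est : (Fin n → (Fin d → F) × A × B) → F) :
    (samplingAlgorithm n est).finalState O =
      prodState (uniformState F d A B) (fun _ => sampleState O) := by
  have h1 := (exists_unitary_mulVec_single (0, 0, 0, fun _ => (0, 0, 0))
    (sum_norm_prodState_sq_eq_one (n := n)
      (sum_norm_uniformState_sq (F := F) (d := d) (A := A) (B := B)))).choose_spec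
  have h2 := foldl_flatMap_samplingRound O (uniformState F d A B) (List.finRange n)
    (List.nodup_finRange n) (fun _ => uniformState F d A B) (fun _ _ => rfl)
  simp only [List.mem_finRange, if_true] at h2
  rw [← h1] at h2
  exact h2

theorem prob_samplingAlgorithm {r : F} (O : HiddenRadiusOracle F d A B r)
    (est : (Fin n → (Fin d → F) × A × B) → F) (v : F) :
    (samplingAlgorithm n est).prob O v =
      ∑ w, if est w = v then ∏ j, ‖sampleState O (w j)‖ ^ 2 else 0 := by
  rw [QueryAlgorithm.prob, finalState_samplingAlgorithm]
  have h := sum_norm_prodState_sq (uniformState F d A B) (fun _ : Fin n => sampleState O)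
    (fun w => est w = v)
  rw [sum_norm_uniformState_sq, one_mul] at h
  exact h

end SamplingAlgorithm

/-! ## The distribution of one sample -/

section OutcomeDistribution

variable {F : Type} [Field F] [Fintype F] {d : ℕ}

/-- Parseval for the indicator of the sphere centred at 0; the form `x - 0` matches the translation
lemma. -/
theorem sum_fourierProb {r : F} (h : (radiusSphere d r).Nonempty) :
    ∑ k : Fin d → F, fourierProb r k = 1 := by
  classical
  have h1 := sum_norm_mulVec_sq (fourierMatrix_mem_unitaryGroup (F := F) (d := d))
    (fun x => if x - 0 ∈ radiusSphere d r then 1 else 0)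
  have h2 : ∀ k, ‖(fourierMatrix F d).mulVec
      (fun x => if x - 0 ∈ radiusSphere d r then 1 else 0) k‖ ^ 2 =
      fourierProb r k * (radiusSphere d r).card := by
    intro k
    rw [Matrix.mulVec, dotProduct, norm_fourierMatrix_mulVec_translate_sq, fourierProb_eq]
    have hN : ((radiusSphere d r).card : ℝ) ≠ 0 := Nat.cast_ne_zero.mpr h.card_pos.ne'
    have hq : (Fintype.card F : ℝ) ^ d ≠ 0 := by simp
    field_simp
  have h3 : ∑ x : Fin d → F, ‖(if x - 0 ∈ radiusSphere d r then 1 else 0 : ℂ)‖ ^ 2 =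
      (radiusSphere d r).card := by
    simp only [sub_zero, apply_ite norm, norm_one, norm_zero, ite_pow, one_pow]
    simp
  simp_rw [h2] at h1
  rw [h3, ← Finset.sum_mul] at h1
  exact mul_right_cancel₀ (Nat.cast_ne_zero.mpr h.card_pos.ne') (h1.trans (one_mul _).symm)

/-- The distribution of one sample when there are `a` offset labels: no offset is found, or a
Fourier sample is obtained. -/
noncomputable def outcomeProb (d a : ℕ) (r : F) : Option (Fin d → F) → ℝ
  | none => 1 - (radiusSphere d r).card / a
  | some k => (radiusSphere d r).card / a * fourierProb r k

theorem outcomeProb_nonneg {a : ℕ} {r : F} (h : (radiusSphere d r).card ≤ a)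
    (o : Option (Fin d → F)) : 0 ≤ outcomeProb d a r o := by
  cases o with
  | none => exact sub_nonneg.mpr (div_le_one_of_le₀ (Nat.cast_le.mpr h) (Nat.cast_nonneg _))
  | some k => exact mul_nonneg (by positivity) (fourierProb_nonneg r k)

theorem sum_outcomeProb (a : ℕ) {r : F} (h : (radiusSphere d r).Nonempty) :
    ∑ o, outcomeProb d a r o = 1 := by
  simp only [Fintype.sum_option, outcomeProb]
  rw [← Finset.mul_sum, sum_fourierProb h]
  ring

/-- The success probabilities s and s' of the two radii may differ. Replacing s' by s costs |s - s'|
in total over all k, which is exactly what the outcome `none` contributes. -/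
theorem fourierTV_le_sum_outcomeProb {a : ℕ} {r r' : F} (h' : (radiusSphere d r').Nonempty) :
    (radiusSphere d r).card / a * fourierTV d r r' ≤
      1 / 2 * ∑ o, |outcomeProb d a r o - outcomeProb d a r' o| := by
  simp only [Fintype.sum_option, outcomeProb, fourierTV]
  set s : ℝ := (radiusSphere d r).card / a
  set s' : ℝ := (radiusSphere d r').card / a
  have hs : 0 ≤ s := by positivity
  have h1 : ∀ k : Fin d → F, s * |fourierProb r k - fourierProb r' k| ≤
      |s * fourierProb r k - s' * fourierProb r' k| + |s - s'| * fourierProb r' k := by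
    intro k
    have h2 : |s - s'| * fourierProb r' k = |s' * fourierProb r' k - s * fourierProb r' k| := by
      rw [← sub_mul, abs_mul, abs_of_nonneg (fourierProb_nonneg r' k), abs_sub_comm]
    have h3 : s * |fourierProb r k - fourierProb r' k| =
        |s * fourierProb r k - s * fourierProb r' k| := by
      rw [← mul_sub, abs_mul, abs_of_nonneg hs]
    rw [h2, h3]
    exact abs_sub_le _ _ _
  have h4 := Finset.sum_le_sum fun k (_ : k ∈ Finset.univ) => h1 k
  rw [← Finset.mul_sum, Finset.sum_add_distrib, ← Finset.mul_sum, sum_fourierProb h', mul_one] at h4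
  rw [show 1 - s - (1 - s') = -(s - s') by ring, abs_neg]
  linarith

/-! ### The effect of one round of queries -/

variable {A B : Type} [AddCommGroup A] [AddCommGroup B] {r : F}

theorem HiddenRadiusOracle.fwd_eq_zero_or (O : HiddenRadiusOracle F d A B r) (x : Fin d → F)
    (a : A) : O.fwd x a = 0 ∨ ∃ s, (O.encOffset s : A) = a := by
  by_cases h : ∃ s, (O.encOffset s : A) = a
  · exact Or.inr h
  · exact Or.inl (dif_neg h)

/-- This is the support of `uniformState` pulled back through a round. A nonblank b means that f₁
answered on a genuine label σ(s); then f₋₁ returns the same label, which forces a = 0. -/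
theorem HiddenRadiusOracle.round_iff (O : HiddenRadiusOracle F d A B r) (x : Fin d → F)
    (a : A) {b : B} (hb : b ≠ 0) :
    b - O.fwd x (O.bwd x b - a) = 0 ↔
      a = 0 ∧ ∃ t, (O.encCenter t : B) = b ∧ x - t ∈ radiusSphere d r := by
  rw [sub_eq_zero]
  constructor
  · intro h
    rcases O.fwd_eq_zero_or x (O.bwd x b - a) with h0 | ⟨s, hs⟩
    · exact absurd (h.trans h0) hb
    · rw [← hs, O.fwd_encOffset] at h
      refine ⟨?_, x - s.1, h.symm, ?_⟩
      · rw [h, O.bwd_encCenter] at hs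
        rw [eq_comm, sub_eq_self] at hs
        exact hs
      · rw [sub_sub_cancel]; exact s.2
  · rintro ⟨rfl, t, rfl, ht⟩
    have h1 := O.bwd_encCenter x ⟨x - t, ht⟩
    have h2 := O.fwd_encOffset x ⟨x - t, ht⟩
    rw [sub_sub_cancel] at h1 h2
    rw [sub_zero, h1, h2]

theorem HiddenRadiusOracle.card_le [Fintype A] (O : HiddenRadiusOracle F d A B r) :
    (radiusSphere d r).card ≤ Fintype.card A := by
  have h := Fintype.card_le_of_injective (fun s => (O.encOffset s : A))
    (Subtype.val_injective.comp O.encOffset.injective)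
  rwa [Fintype.card_coe] at h

variable [Fintype A] [Fintype B] [DecidableEq B]

/-- What is used of the content of a slot. -/
def slotOutcome (y : (Fin d → F) × A × B) : Option (Fin d → F) :=
  if y.2.2 = 0 then none else some y.1

omit [Fintype B] in
open scoped Classical in
theorem sampleState_of_ne_zero (O : HiddenRadiusOracle F d A B r) (k : Fin d → F) (a : A) {b : B}
    (hb : b ≠ 0) : sampleState O (k, a, b) = if a = 0 ∧ ∃ t, (O.encCenter t : B) = b then
      ((1 / Real.sqrt ((Fintype.card F : ℝ) ^ d * Fintype.card A) : ℝ) : ℂ) *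
        ∑ x, fourierMatrix F d k x *
          (if ∃ t, (O.encCenter t : B) = b ∧ x - t ∈ radiusSphere d r then 1 else 0)
      else 0 := by
  simp only [sampleState, pointFourier, roundState, uniformState, O.round_iff _ a hb]
  split_ifs with h
  · rw [Finset.mul_sum]
    refine Finset.sum_congr rfl fun x _ => ?_
    simp only [h.1, true_and, mul_ite, mul_one, mul_zero]
    split_ifs <;> ring
  · refine Finset.sum_eq_zero fun x _ => ?_
    rw [if_neg, mul_zero]
    rintro ⟨ha, t, ht, _⟩
    exact h ⟨ha, t, ht⟩

omit [Fintype B] in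
theorem norm_sampleState_encCenter_sq (O : HiddenRadiusOracle F d A B r) (k t : Fin d → F) :
    ‖sampleState O (k, 0, O.encCenter t)‖ ^ 2 =
      ‖sphereFourier r k‖ ^ 2 / (Fintype.card F : ℝ) ^ d /
        ((Fintype.card F : ℝ) ^ d * Fintype.card A) := by
  classical
  rw [sampleState_of_ne_zero O k 0 (O.encCenter t).2, if_pos ⟨rfl, t, rfl⟩]
  have h : ∀ x : Fin d → F, (∃ t', (O.encCenter t' : B) = O.encCenter t ∧
      x - t' ∈ radiusSphere d r) ↔ x - t ∈ radiusSphere d r := by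
    intro x
    constructor
    · rintro ⟨t', h1, h2⟩
      rwa [← O.encCenter.injective (Subtype.ext h1)]
    · exact fun h => ⟨t, rfl, h⟩
  simp_rw [h]
  rw [norm_mul, mul_pow, norm_fourierMatrix_mulVec_translate_sq, Complex.norm_real,
    Real.norm_eq_abs, sq_abs, div_pow, Real.sq_sqrt (by positivity)]
  ring

omit [DecidableEq B] in
theorem sum_norm_roundState_sq (O : HiddenRadiusOracle F d A B r)
    (g : (Fin d → F) × A × B → ℂ) : ∑ y, ‖roundState O g y‖ ^ 2 = ∑ y, ‖g y‖ ^ 2 := by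
  simp only [Fintype.sum_prod_type, roundState]
  refine Finset.sum_congr rfl fun x _ => ?_
  rw [Finset.sum_comm]
  have h1 : ∀ b, ∑ a, ‖g (x, O.bwd x b - a, b - O.fwd x (O.bwd x b - a))‖ ^ 2 =
      ∑ a, ‖g (x, a, b - O.fwd x a)‖ ^ 2 := fun b =>
    Equiv.sum_comp (Equiv.subLeft (O.bwd x b)) fun a => ‖g (x, a, b - O.fwd x a)‖ ^ 2
  simp_rw [h1]
  rw [Finset.sum_comm]
  exact Finset.sum_congr rfl fun a _ =>
    Equiv.sum_comp (Equiv.subRight (O.fwd x a)) fun b => ‖g (x, a, b)‖ ^ 2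

variable [DecidableEq F]

omit [AddCommGroup A] [AddCommGroup B] [DecidableEq B] in
theorem sum_norm_pointFourier_sq (g : (Fin d → F) × A × B → ℂ) :
    ∑ y, ‖pointFourier g y‖ ^ 2 = ∑ y, ‖g y‖ ^ 2 := by
  simp only [Fintype.sum_prod_type (α₁ := Fin d → F)]
  rw [Finset.sum_comm, Finset.sum_comm (s := Finset.univ (α := Fin d → F))]
  exact Finset.sum_congr rfl fun z _ =>
    sum_norm_mulVec_sq fourierMatrix_mem_unitaryGroup fun x => g (x, z)

variable [DecidableEq A]

omit [DecidableEq A] in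
theorem sum_norm_sampleState_sq (O : HiddenRadiusOracle F d A B r) :
    ∑ y, ‖sampleState O y‖ ^ 2 = 1 := by
  rw [sampleState, sum_norm_pointFourier_sq, sum_norm_roundState_sq, sum_norm_uniformState_sq]

theorem sum_norm_sampleState_sq_of_some (O : HiddenRadiusOracle F d A B r)
    (h : (radiusSphere d r).Nonempty) (k : Fin d → F) :
    ∑ y, (if slotOutcome y = some k then ‖sampleState O y‖ ^ 2 else 0) =
      outcomeProb d (Fintype.card A) r (some k) := by
  classical
  have h1 : ∀ (k' : Fin d → F) (a : A) (b : B),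
      (if slotOutcome (k', a, b) = some k then ‖sampleState O (k', a, b)‖ ^ 2 else 0) =
      if k' = k then if a = 0 then if ∃ t, (O.encCenter t : B) = b then
        ‖sampleState O (k, 0, b)‖ ^ 2 else 0 else 0 else 0 := by
    intro k' a b
    rcases eq_or_ne b 0 with rfl | hb
    · have : ¬ ∃ t, (O.encCenter t : B) = 0 := fun ⟨t, ht⟩ => (O.encCenter t).2 ht
      simp [slotOutcome, this]
    · simp only [slotOutcome, hb, if_false, Option.some.injEq]
      by_cases hk : k' = k
      · subst hk
        by_cases ha : a = 0
        · subst ha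
          by_cases ht : ∃ t, (O.encCenter t : B) = b
          · rw [if_pos rfl, if_pos rfl, if_pos rfl, if_pos ht]
          · rw [if_pos rfl, if_pos rfl, if_pos rfl, if_neg ht, sampleState_of_ne_zero O _ _ hb,
              if_neg (by tauto)]
            simp
        · rw [if_pos rfl, if_pos rfl, if_neg ha, sampleState_of_ne_zero O _ _ hb,
              if_neg (by tauto)]
          simp
      · rw [if_neg hk, if_neg hk]
  simp only [Fintype.sum_prod_type, h1]
  -- Injectivity of τ turns the sum over labels into one over the q^d centres, which all contribute
  -- equally.
  have h2 : ∑ b, (if ∃ t, (O.encCenter t : B) = b then ‖sampleState O (k, 0, b)‖ ^ 2 else 0) =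
      ∑ t, ‖sampleState O (k, 0, (O.encCenter t : B))‖ ^ 2 := by
    rw [← Finset.sum_filter]
    have h3 : (Finset.univ.filter fun b => ∃ t, (O.encCenter t : B) = b) =
        Finset.univ.image fun t => (O.encCenter t : B) := by
      ext b; simp
    rw [h3, Finset.sum_image]
    intro t _ t' _ htt
    exact O.encCenter.injective (Subtype.ext htt)
  have h4 : ∀ (P : Prop) [Decidable P] (f : B → ℝ),
      ∑ b, (if P then f b else 0) = if P then ∑ b, f b else 0 := by
    intro P _ f; split_ifs <;> simp
  have h5 : ∀ (P : Prop) [Decidable P] (f : A → ℝ),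
      ∑ b, (if P then f b else 0) = if P then ∑ b, f b else 0 := by
    intro P _ f; split_ifs <;> simp
  simp only [h4, h5, Finset.sum_ite_eq', Finset.mem_univ, if_true, h2,
    norm_sampleState_encCenter_sq, outcomeProb, fourierProb_eq]
  rw [Finset.sum_const, Finset.card_univ, Fintype.card_fun, Fintype.card_fin, nsmul_eq_mul]
  have hN : ((radiusSphere d r).card : ℝ) ≠ 0 := Nat.cast_ne_zero.mpr h.card_pos.ne'
  have hq : (Fintype.card F : ℝ) ≠ 0 := by simp
  push_cast
  field_simp

/-- The outcome `none` follows by subtraction, since both sides have total mass 1; the blank branch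
is never computed. -/
theorem sum_norm_sampleState_sq_eq (O : HiddenRadiusOracle F d A B r)
    (h : (radiusSphere d r).Nonempty) (o : Option (Fin d → F)) :
    ∑ y, (if slotOutcome y = o then ‖sampleState O y‖ ^ 2 else 0) =
      outcomeProb d (Fintype.card A) r o := by
  cases o with
  | some k => exact sum_norm_sampleState_sq_of_some O h k
  | none =>
    have h1 : ∑ o, ∑ y, (if slotOutcome y = o then ‖sampleState O y‖ ^ 2 else 0) =
        ∑ o, outcomeProb d (Fintype.card A) r o := by
      rw [Finset.sum_comm, sum_outcomeProb _ h, ← sum_norm_sampleState_sq O]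
      simp
    rw [Fintype.sum_option, Fintype.sum_option,
      Finset.sum_congr rfl fun k _ => sum_norm_sampleState_sq_of_some O h k] at h1
    exact add_right_cancel h1

end OutcomeDistribution

/-! ## Maximum likelihood estimation -/

section MaximumLikelihood

/-- Cauchy–Schwarz on |P - Q| = |√P - √Q|(√P + √Q) gives τ² ≤ 1 - β² for the Bhattacharyya
coefficient β, and β ≤ (1 + β²)/2. -/
theorem sum_sqrt_mul_le {O : Type*} [Fintype O] {P Q : O → ℝ} (hP : ∀ o, 0 ≤ P o)
    (hQ : ∀ o, 0 ≤ Q o) (hP1 : ∑ o, P o = 1) (hQ1 : ∑ o, Q o = 1) {τ : ℝ} (hτ : 0 ≤ τ)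
    (h : τ ≤ 1 / 2 * ∑ o, |P o - Q o|) : ∑ o, √(P o * Q o) ≤ 1 - τ ^ 2 / 2 := by
  have h1 : ∀ o, |P o - Q o| = |√(P o) - √(Q o)| * (√(P o) + √(Q o)) := by
    intro o
    rw [← abs_of_nonneg (add_nonneg (Real.sqrt_nonneg (P o)) (Real.sqrt_nonneg (Q o))), ← abs_mul]
    congr 1
    linear_combination -(Real.sq_sqrt (hP o)) + Real.sq_sqrt (hQ o)
  have h2 := Finset.sum_mul_sq_le_sq_mul_sq Finset.univ (fun o => |√(P o) - √(Q o)|)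
    (fun o => √(P o) + √(Q o))
  simp_rw [← h1, sq_abs] at h2
  have h3 : ∑ o, (√(P o) - √(Q o)) ^ 2 = 2 - 2 * ∑ o, √(P o * Q o) := by
    have : ∀ o, (√(P o) - √(Q o)) ^ 2 = P o + Q o - 2 * √(P o * Q o) := by
      intro o
      rw [Real.sqrt_mul (hP o)]
      linear_combination Real.sq_sqrt (hP o) + Real.sq_sqrt (hQ o)
    simp_rw [this]
    rw [Finset.sum_sub_distrib, Finset.sum_add_distrib, hP1, hQ1, Finset.mul_sum]
    norm_num
  have h4 : ∑ o, (√(P o) + √(Q o)) ^ 2 = 2 + 2 * ∑ o, √(P o * Q o) := by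
    have : ∀ o, (√(P o) + √(Q o)) ^ 2 = P o + Q o + 2 * √(P o * Q o) := by
      intro o
      rw [Real.sqrt_mul (hP o)]
      linear_combination Real.sq_sqrt (hP o) + Real.sq_sqrt (hQ o)
    simp_rw [this]
    rw [Finset.sum_add_distrib, Finset.sum_add_distrib, hP1, hQ1, Finset.mul_sum]
    norm_num
  rw [h3, h4] at h2
  have h5 : (2 * τ) ^ 2 ≤ (∑ o, |P o - Q o|) ^ 2 := by
    apply pow_le_pow_left₀ (by linarith)
    linarith
  nlinarith [sq_nonneg (∑ o, √(P o * Q o) - 1)]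

/-- Chernoff's argument: where Q is at least as likely as P, the factor ∏ √(Q/P) is at least 1, and
its expectation factorizes into a power of the Bhattacharyya coefficient. -/
theorem sum_prod_of_le_le_pow {Y O : Type*} [Fintype Y] [Fintype O] [DecidableEq O] {n : ℕ}
    {p : Y → ℝ} {P Q : O → ℝ} {cls : Y → O} (hp : ∀ y, 0 ≤ p y) (hP : ∀ o, 0 ≤ P o)
    (hQ : ∀ o, 0 ≤ Q o) (h : ∀ o, ∑ y, (if cls y = o then p y else 0) = P o)
    [DecidablePred fun w : Fin n → Y => ∏ j, P (cls (w j)) ≤ ∏ j, Q (cls (w j))] :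
    ∑ w : Fin n → Y, (if ∏ j, P (cls (w j)) ≤ ∏ j, Q (cls (w j)) then ∏ j, p (w j) else 0) ≤
      (∑ o, √(P o * Q o)) ^ n := by
  have hpP : ∀ y, p y ≤ P (cls y) := by
    intro y
    rw [← h]
    refine le_trans ?_ (Finset.single_le_sum (fun z _ => ?_) (Finset.mem_univ y))
    · rw [if_pos rfl]
    · split_ifs
      exacts [hp z, le_rfl]
  have h1 : ∑ o, √(P o * Q o) = ∑ y, p y * √(Q (cls y) / P (cls y)) := by
    have h2 : ∀ o, √(P o * Q o) = ∑ y, if cls y = o then p y * √(Q (cls y) / P (cls y)) else 0 := by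
      intro o
      have h3 : ∀ y, (if cls y = o then p y * √(Q (cls y) / P (cls y)) else 0) =
          (if cls y = o then p y else 0) * √(Q o / P o) := by
        intro y
        split_ifs with hy
        · rw [hy]
        · rw [zero_mul]
      simp_rw [h3]
      rw [← Finset.sum_mul, h]
      rcases eq_or_lt_of_le (hP o) with h0 | h0
      · simp [← h0]
      · rw [← Real.sqrt_sq (hP o), ← Real.sqrt_mul (sq_nonneg _), Real.sqrt_sq (hP o)]
        congr 1
        field_simp
    simp_rw [h2]
    rw [Finset.sum_comm]
    simp
  rw [h1, Fintype.sum_pow]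
  refine Finset.sum_le_sum fun w _ => ?_
  have h0 : 0 ≤ ∏ j, p (w j) * √(Q (cls (w j)) / P (cls (w j))) :=
    Finset.prod_nonneg fun j _ => mul_nonneg (hp _) (Real.sqrt_nonneg _)
  split_ifs with hw
  -- If some P vanishes the quotient is a default 0, but then p vanishes there too.
  · by_cases hz : ∃ j, P (cls (w j)) = 0
    · obtain ⟨j, hj⟩ := hz
      rwa [Finset.prod_eq_zero (Finset.mem_univ j)
        (le_antisymm ((hpP (w j)).trans hj.le) (hp _))]
    · push Not at hz
      have hpos : 0 < ∏ j, P (cls (w j)) :=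
        Finset.prod_pos fun j _ => lt_of_le_of_ne (hP _) (hz j).symm
      rw [Finset.prod_mul_distrib]
      refine le_mul_of_one_le_right (Finset.prod_nonneg fun j _ => hp _) ?_
      have h4 : (∏ j, √(Q (cls (w j)) / P (cls (w j)))) ^ 2 =
          (∏ j, Q (cls (w j))) / ∏ j, P (cls (w j)) := by
        rw [← Finset.prod_pow, ← Finset.prod_div_distrib]
        exact Finset.prod_congr rfl fun j _ => Real.sq_sqrt (div_nonneg (hQ _) (hP _))
      rw [← one_le_sq_iff₀ (Finset.prod_nonneg fun j _ => Real.sqrt_nonneg _), h4,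
        one_le_div hpos]
      exact hw
  · exact h0

open scoped Classical in
/-- The strict maximizer of `L` among the candidates satisfying `S`, if there is one. -/
noncomputable def strictArgmax {F : Type*} [Zero F] (S : F → Prop) (L : F → ℝ) : F :=
  if h : ∃ v, S v ∧ ∀ v', S v' → v' ≠ v → L v' < L v then h.choose else 0

theorem strictArgmax_eq {F : Type*} [Zero F] {S : F → Prop} {L : F → ℝ} {v : F} (hv : S v)
    (h : ∀ v', S v' → v' ≠ v → L v' < L v) : strictArgmax S L = v := by
  have h1 : ∃ v, S v ∧ ∀ v', S v' → v' ≠ v → L v' < L v := ⟨v, hv, h⟩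
  rw [strictArgmax, dif_pos h1]
  by_contra hne
  exact lt_asymm (h _ h1.choose_spec.1 hne) (h1.choose_spec.2 v hv (Ne.symm hne))

/-- Union bound over the rivals: the estimate can miss r only if some rival is at least as likely.
Ties count as errors, hence ≤ in the error event. -/
theorem one_sub_le_sum_strictArgmax {F Y O : Type*} [Zero F] [Fintype F] [DecidableEq F]
    [Fintype Y] [Fintype O] [DecidableEq O] (n : ℕ) {p : Y → ℝ} {cls : Y → O} {S : F → Prop}
    {P : F → O → ℝ} {r : F} {ρ : ℝ} (hp : ∀ y, 0 ≤ p y) (hp1 : ∑ y, p y = 1)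
    (hP : ∀ v, S v → ∀ o, 0 ≤ P v o) (hr : S r)
    (h : ∀ o, ∑ y, (if cls y = o then p y else 0) = P r o) (hρ : 0 ≤ ρ)
    (hBC : ∀ v, S v → v ≠ r → ∑ o, √(P r o * P v o) ≤ ρ) :
    1 - Fintype.card F * ρ ^ n ≤ ∑ w : Fin n → Y,
      if strictArgmax S (fun v => ∏ j, P v (cls (w j))) = r then ∏ j, p (w j) else 0 := by
  classical
  have h1 : ∑ w : Fin n → Y, ∏ j, p (w j) = 1 := by
    rw [← Fintype.sum_pow, hp1, one_pow]
  have h2 : ∑ w : Fin n → Y, ∏ j, p (w j) ≤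
      ∑ w : Fin n → Y, ((if strictArgmax S (fun v => ∏ j, P v (cls (w j))) = r then
        ∏ j, p (w j) else 0) + ∑ v, if S v ∧ v ≠ r then
          if ∏ j, P r (cls (w j)) ≤ ∏ j, P v (cls (w j)) then ∏ j, p (w j) else 0 else 0) := by
    refine Finset.sum_le_sum fun w _ => ?_
    have h0 : 0 ≤ ∏ j, p (w j) := Finset.prod_nonneg fun j _ => hp _
    have h3 : ∀ v ∈ Finset.univ, 0 ≤ if S v ∧ v ≠ r then
        if ∏ j, P r (cls (w j)) ≤ ∏ j, P v (cls (w j)) then ∏ j, p (w j) else 0 else 0 := by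
      intro v _
      split_ifs <;> first | exact h0 | exact le_rfl
    by_cases he : strictArgmax S (fun v => ∏ j, P v (cls (w j))) = r
    · rw [if_pos he]
      exact le_add_of_nonneg_right (Finset.sum_nonneg h3)
    · rw [if_neg he, zero_add]
      have h4 : ∃ v, S v ∧ v ≠ r ∧ ∏ j, P r (cls (w j)) ≤ ∏ j, P v (cls (w j)) := by
        by_contra hno
        push Not at hno
        exact he (strictArgmax_eq hr hno)
      obtain ⟨v, hv, hvr, hle⟩ := h4
      refine le_trans ?_ (Finset.single_le_sum h3 (Finset.mem_univ v))
      rw [if_pos ⟨hv, hvr⟩, if_pos hle]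
  rw [h1, Finset.sum_add_distrib, Finset.sum_comm (s := Finset.univ (α := Fin n → Y))] at h2
  have h5 : ∑ v, ∑ w : Fin n → Y, (if S v ∧ v ≠ r then
      if ∏ j, P r (cls (w j)) ≤ ∏ j, P v (cls (w j)) then ∏ j, p (w j) else 0 else 0) ≤
      ∑ _v : F, ρ ^ n := by
    refine Finset.sum_le_sum fun v _ => ?_
    by_cases hv : S v ∧ v ≠ r
    · simp only [if_pos hv]
      refine (sum_prod_of_le_le_pow hp (hP r hr) (hP v hv.1) h).trans ?_
      exact pow_le_pow_left₀ (Finset.sum_nonneg fun _ _ => Real.sqrt_nonneg _)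
        (hBC v hv.1 hv.2) n
    · simp only [if_neg hv, Finset.sum_const_zero]
      exact pow_nonneg hρ n
  rw [Finset.sum_const, Finset.card_univ, nsmul_eq_mul] at h5
  linarith

end MaximumLikelihood

/-! ## The hidden radius problem -/

section HiddenRadiusProblem

variable {F : Type} [Field F] [Fintype F] [DecidableEq F] {d : ℕ}
  {A B : Type} [AddCommGroup A] [Fintype A] [DecidableEq A]
  [AddCommGroup B] [Fintype B] [DecidableEq B]

theorem exists_queryAlgorithm {K : ℕ} (hq : Odd (Fintype.card F)) (hd : Odd d)
    (hA : Fintype.card A ≤ K * Fintype.card F ^ (d - 1)) (n : ℕ) :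
    ∃ alg : QueryAlgorithm F d A B, alg.numQueries = 2 * n ∧
      ∀ r : F, (radiusSphere d r).Nonempty → ∀ O : HiddenRadiusOracle F d A B r,
        1 - Fintype.card F * (1 - (1 / (18 * K)) ^ 2 / 2 : ℝ) ^ n ≤ alg.prob O r := by
  -- Nonemptiness makes the outcome probabilities sum to 1, and the size bound makes that of `none`
  -- nonnegative. The true radius qualifies because σ is injective.
  let S : F → Prop := fun v =>
    (radiusSphere d v).Nonempty ∧ (radiusSphere d v).card ≤ Fintype.card A
  let est : (Fin n → (Fin d → F) × A × B) → F := fun w =>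
    strictArgmax S fun v => ∏ j, outcomeProb d (Fintype.card A) v (slotOutcome (w j))
  have hApos : 0 < Fintype.card A := Fintype.card_pos
  have hK : (1 : ℝ) ≤ K := by
    have : K ≠ 0 := by rintro rfl; omega
    exact_mod_cast Nat.one_le_iff_ne_zero.mpr this
  have hqpos : (0 : ℝ) < Fintype.card F := by exact_mod_cast Fintype.card_pos
  refine ⟨samplingAlgorithm n est, numQueries_samplingAlgorithm est, fun r hr O => ?_⟩
  rw [prob_samplingAlgorithm]
  refine one_sub_le_sum_strictArgmax n (S := S) (P := outcomeProb d (Fintype.card A))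
    (p := fun y => ‖sampleState O y‖ ^ 2)
    (fun y => by positivity) (sum_norm_sampleState_sq O)
    (fun v hv => outcomeProb_nonneg hv.2) ⟨hr, O.card_le⟩ (sum_norm_sampleState_sq_eq O hr) ?_ ?_
  · have : 1 / (18 * (K : ℝ)) ≤ 1 := by
      rw [div_le_one (by linarith)]; linarith
    have h0 : 0 ≤ 1 / (18 * (K : ℝ)) := by positivity
    nlinarith
  · intro v hv hvr
    refine sum_sqrt_mul_le (outcomeProb_nonneg O.card_le) (outcomeProb_nonneg hv.2)
      (sum_outcomeProb _ hr) (sum_outcomeProb _ hv.1) (by positivity) ?_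
    refine le_trans ?_ (fourierTV_le_sum_outcomeProb hv.1)
    have h1 := fourierTV_ge hq hd hr hv.1 hvr.symm
    have h2 := card_radiusSphere_ge_of_nonempty hq hd hr
    have h3 : 2 / (3 * (K : ℝ)) ≤ (radiusSphere d r).card / Fintype.card A := by
      have hA' : (Fintype.card A : ℝ) ≤ K * (Fintype.card F : ℝ) ^ (d - 1) := by exact_mod_cast hA
      rw [div_le_div_iff₀ (by positivity) (by exact_mod_cast hApos)]
      calc 2 * (Fintype.card A : ℝ) ≤ 2 * (K * (Fintype.card F : ℝ) ^ (d - 1)) := by gcongr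
        _ = 2 / 3 * (Fintype.card F : ℝ) ^ (d - 1) * (3 * K) := by ring
        _ ≤ _ := by gcongr
    -- The success probability is at least 2/(3K) and the Fourier samples are 1/12 apart.
    calc 1 / (18 * (K : ℝ)) = 2 / (3 * K) * (1 / 12) := by field_simp; norm_num
      _ ≤ _ := by gcongr

/-- From 1 - τ ≤ e^(-τ), about (log q - log ε)/τ samples suffice. As q ≥ 3 > e, log q ≥ 1 absorbs
the constants; |log ε| also covers ε > 1. -/
theorem exists_sample_size {τ ε : ℝ} (hτ : 0 < τ) (hτ1 : τ ≤ 1) (hε : 0 < ε) {q : ℝ}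
    (hq : 3 ≤ q) : ∃ n : ℕ, ((2 * n : ℕ) : ℝ) ≤
      2 * ((1 + |Real.log ε|) / τ + 1) * Real.log q ^ 1 ∧ q * (1 - τ) ^ n ≤ ε := by
  have hlog : 1 ≤ Real.log q := by
    rw [Real.le_log_iff_exp_le (by linarith)]
    linarith [Real.exp_one_lt_three]
  have hle : (Real.log q - Real.log ε) / τ ≤ (1 + |Real.log ε|) / τ * Real.log q := by
    rw [div_mul_eq_mul_div]
    gcongr
    nlinarith [neg_abs_le (Real.log ε), abs_nonneg (Real.log ε)]
  have h0 : 0 ≤ (1 + |Real.log ε|) / τ * Real.log q := by positivity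
  refine ⟨⌈(Real.log q - Real.log ε) / τ⌉₊, ?_, ?_⟩
  · have h1 : (⌈(Real.log q - Real.log ε) / τ⌉₊ : ℝ) ≤
        (1 + |Real.log ε|) / τ * Real.log q + 1 :=
      (Nat.cast_le.mpr (Nat.ceil_mono hle)).trans (Nat.ceil_lt_add_one h0).le
    push_cast
    rw [pow_one]
    linarith
  · have h1 := Nat.le_ceil ((Real.log q - Real.log ε) / τ)
    set n := ⌈(Real.log q - Real.log ε) / τ⌉₊
    rw [div_le_iff₀ hτ] at h1
    calc q * (1 - τ) ^ n ≤ q * Real.exp (-τ) ^ n := by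
          gcongr
          · linarith [Real.add_one_le_exp (-τ)]
      _ = Real.exp (Real.log q + n * -τ) := by
          rw [Real.exp_add, Real.exp_log (by linarith), Real.exp_nat_mul]
      _ ≤ Real.exp (Real.log ε) := Real.exp_le_exp.mpr (by linarith)
      _ = ε := Real.exp_log hε

end HiddenRadiusProblem

theorem mainTheorem4 :
    -- query complexity of the hidden radius problem in odd dimension
    (∀ (K : ℕ) (ε : ℝ), 0 < ε → ∃ (C : ℝ) (c : ℕ),
      ∀ (F : Type) [Field F] [Fintype F] [DecidableEq F] (d : ℕ)
        (A B : Type) [AddCommGroup A] [Fintype A] [DecidableEq A]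
        [AddCommGroup B] [Fintype B] [DecidableEq B],
        Odd (Fintype.card F) → Odd d → Fintype.card A ≤ K * Fintype.card F ^ (d - 1) →
        ∃ alg : QueryAlgorithm F d A B,
          (alg.numQueries : ℝ) ≤ C * Real.log (Fintype.card F) ^ c ∧
          ∀ r : F, (radiusSphere d r).Nonempty →
            ∀ O : HiddenRadiusOracle F d A B r, 1 - ε ≤ alg.prob O r) ∧
    -- constant total variation distance for any two distinct radii
    (∃ δ : ℝ, 0 < δ ∧
      ∀ (F : Type) [Field F] [Fintype F] (d : ℕ) (r r' : F),
        Odd (Fintype.card F) → Odd d →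
        (radiusSphere d r).Nonempty → (radiusSphere d r').Nonempty → r ≠ r' →
        δ ≤ fourierTV d r r') ∧
    -- explicit constant for two radii with the same quadratic character
    (∀ (F : Type) [Field F] [Fintype F] [DecidableEq F] (d : ℕ) (r r' : F),
        Odd (Fintype.card F) → Odd d →
        (radiusSphere d r).Nonempty → (radiusSphere d r').Nonempty → r ≠ r' →
        quadraticChar F r = quadraticChar F r' →
        1 / 4 ≤ fourierTV d r r') := by
  refine ⟨fun K ε hε => ?_, ⟨1 / 12, by norm_num, fun F _ _ d r r' hq hd h h' hne =>
    fourierTV_ge hq hd h h' hne⟩, fun F _ _ _ d r r' hq hd h _ hne hχ =>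
    fourierTV_ge_of_quadraticChar_eq hq hd h hne hχ⟩
  -- The sample size bound with τ = (1/(18K))²/2. For K = 0 the constant is a default value, but no
  -- group A then satisfies the size hypothesis.
  refine ⟨2 * ((1 + |Real.log ε|) / ((1 / (18 * K)) ^ 2 / 2) + 1), 1, ?_⟩
  intro F _ _ _ d A B _ _ _ _ _ _ hq hd hA
  have hK : (1 : ℝ) ≤ K := by
    have hApos : 0 < Fintype.card A := Fintype.card_pos
    have : K ≠ 0 := by rintro rfl; omega
    exact_mod_cast Nat.one_le_iff_ne_zero.mpr this
  have hK1 : 1 / (18 * (K : ℝ)) ≤ 1 := by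
    rw [div_le_one (by linarith)]; linarith
  have hK0 : 0 < 1 / (18 * (K : ℝ)) := by positivity
  obtain ⟨n, hn, hn'⟩ := exists_sample_size (τ := (1 / (18 * (K : ℝ))) ^ 2 / 2) (by positivity)
    (by nlinarith) hε (q := Fintype.card F) (by exact_mod_cast three_le_card_of_odd hq)
  obtain ⟨alg, h1, h2⟩ := exists_queryAlgorithm (B := B) hq hd hA n
  refine ⟨alg, ?_, fun r hr O => le_trans (by linarith) (h2 r hr O)⟩
  rw [h1]
  exact hn
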